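/- Let $\mathbb K$ be a field of characteristic $0$ and let $L$ be a Lie algebra over $\mathbb K$ that is separated and complete for the topology of its lower central series $L^1=L$, $L^{n+1}=[L^n,L]$; infinite sums in $L$ converge in this topology. Let $\bullet\colon L\times L\to L$ be the Baker–Campbell–Hausdorff product: $a\bullet b=\sum_{n\ge1}w_n(a,b)$, where $w_n(x,y)$ is the unique element of the free Lie algebra on $x,y$ over $\mathbb K$ whose image in the free associative algebra is the homogeneous component of degree $n$ of $\log(e^xe^y)$. It is associative. Let $\mathcal B_n$ be the set of planar binary rooted trees with $n$ leaves (every internal vertex has exactly two incoming edges, a left and a right one; edges are directed towards the root), and $\mathcal B=\bigcup_{n>0}\mathcal B_n$. For $\Gamma\in\mathcal B$ let $L(\Gamma)$ be its set of leaves, and write $u\to v$ if the vertex $v$ lies on the directed path from $u$ to the root. A rightmost branch of $\Gamma$ is a maximal connected subgraph all of whose edges are right edges; it is non-trivial if it has at least two vertices. A subroot is the vertex nearest to the root of a non-trivial rightmost branch; $R(\Gamma)$ is the set of subroots. For an internal vertex $v$, let $m(v)$ be the leaf on the rightmost branch containing $v$, and $d(v)$ the distance from $v$ to $m(v)$. For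 leaves $l_1,l_2$ put $l_1\preceq l_2$ if $l_1=l_2$ or if there is $v\in R(\Gamma)$ with $l_2=m(v)$ and $l_1\to v$. For a poset $A$, let $\mathcal B(A)$ (respectively $\mathcal B_n(A)$) be the set of pairs $(\Gamma,f)$ with $\Gamma\in\mathcal B$ (respectively $\Gamma\in\mathcal B_n$) and $f\colon(L(\Gamma),\preceq)\to(A,\le)$ monotone. For $(\Gamma,f)\in\mathcal B(A)$ put $$b_{(\Gamma,f)}=\prod_{v\in R(\Gamma)}\frac{b_{d(v)}}{t(v)},\qquad t(v)=\#\{u\in L(\Gamma): u\to v,\ f(u)=f(m(v))\},$$ where $\sum_{n\ge0}b_nx^n=\frac{x}{e^x-1}$, that is, $b_n=B_n/n!$ with $B_n$ the Bernoulli numbers ($B_1=-\tfrac12$). For $a_1,\dots,a_k\in L$, let $\mathcal B(a_1\le\dots\le a_k)$ be the set $\mathcal B(A)$ for the chain $A$ of $k$ distinct formal labels $a_1<\dots<a_k$ (labels are kept distinct even if the corresponding elements of $L$ coincide), and similarly $\mathcal B_n(a_1\le\dots\le a_k)$; let $Z_\Gamma(f)\in L$ be the iterated bracket obtained by replacing each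 label by the corresponding element of $L$ and taking, at every internal vertex, the Lie bracket of the left and the right subtree. Then, for every positive integer $k$ and all $a_1,\dots,a_k\in L$, $$a_k\bullet a_{k-1}\bullet\cdots\bullet a_1=\sum_{(\Gamma,f)\in\mathcal B(a_1\le a_2\le\cdots\le a_k)}b_{(\Gamma,f)}Z_\Gamma(f),$$ $$a_1\bullet a_2\bullet\cdots\bullet a_k=\sum_{n=1}^{+\infty}(-1)^{n-1}\sum_{(\Gamma,f)\in\mathcal B_n(a_1\le a_2\le\cdots\le a_k)}b_{(\Gamma,f)}Z_\Gamma(f).$$ In particular, for all $a,b\in L$, $$a\bullet b=\sum_{(\Gamma,f)\in\mathcal B(b\le a)}b_{(\Gamma,f)}Z_\Gamma(f).$$ -/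

import Mathlib

open scoped Nat

/-! ### Lie algebras that are complete for the lower central series -/

section LowerCentral

variable (K : Type*) {L : Type*} [Field K] [LieRing L] [LieAlgebra K L]

/-- The series `∑ i, s i` converges to `c` in the topology of `L` whose neighbourhoods of `0` are
the terms of the lower central series. Mathlib's `lowerCentralSeries K L L m` is the term
`L^(m+1)` in the numbering `L^1 = L`, `L^(n+1) = [L^n, L]`. -/
def LCSHasSum {ι : Type*} (s : ι → L) (c : L) : Prop :=
  ∀ m : ℕ, ∃ F₀ : Finset ι, ∀ F : Finset ι, F₀ ⊆ F →
    (∑ i ∈ F, s i) - c ∈ LieModule.lowerCentralSeries K L L m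

variable (L) in
/-- `L` is separated and complete for the topology of its lower central series. -/
structure IsLCSComplete : Prop where
  separated : ∀ x : L, (∀ m : ℕ, x ∈ LieModule.lowerCentralSeries K L L m) → x = 0
  complete : ∀ s : ℕ → L,
    (∀ m : ℕ, ∃ N : ℕ, ∀ p q : ℕ, N ≤ p → N ≤ q →
      s p - s q ∈ LieModule.lowerCentralSeries K L L m) →
    ∃ c : L, ∀ m : ℕ, ∃ N : ℕ, ∀ p : ℕ, N ≤ p →
      s p - c ∈ LieModule.lowerCentralSeries K L L m

end LowerCentral

/-! ### The Baker-Campbell-Hausdorff product -/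

section BCH

/-- The series `exp (T x) = ∑ n, x ^ n / n! T ^ n` in a central variable `T`. -/
noncomputable def expSeries (K : Type*) {R : Type*} [Field K] [Ring R] [Algebra K R] (x : R) :
    PowerSeries R :=
  PowerSeries.mk fun n => ((n ! : K)⁻¹) • x ^ n

/-- The coefficient of `T ^ n` in `log E = ∑ m ≥ 1, (-1) ^ (m - 1) / m (E - 1) ^ m`, for a power
series `E` with constant term `1` (the powers with `m > n` do not contribute to it). -/
noncomputable def logCoeff (K : Type*) {R : Type*} [Field K] [Ring R] [Algebra K R]
    (E : PowerSeries R) (n : ℕ) : R :=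
  ∑ m ∈ Finset.Icc 1 n, ((-1 : K) ^ (m - 1) / (m : K)) • PowerSeries.coeff n ((E - 1) ^ m)

variable (K : Type*) [Field K]

/-- The homogeneous component of degree `n` of `log (e^x e^y)`, a noncommutative polynomial in the
two variables `x` (index `0`) and `y` (index `1`). -/
noncomputable def bchPoly (n : ℕ) : FreeAlgebra K (Fin 2) :=
  logCoeff K (expSeries K (FreeAlgebra.ι K (0 : Fin 2)) * expSeries K (FreeAlgebra.ι K (1 : Fin 2))) n

attribute [local instance] LieRing.ofAssociativeRing

/-- The canonical map from Lie polynomials to noncommutative polynomials. -/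
noncomputable def lieToFree : FreeLieAlgebra K (Fin 2) →ₗ⁅K⁆ FreeAlgebra K (Fin 2) :=
  FreeLieAlgebra.lift K (FreeAlgebra.ι K)

/-- The Lie polynomial `w_n(x, y)` with image the degree `n` component of `log (e^x e^y)`. -/
noncomputable def bchLie (n : ℕ) : FreeLieAlgebra K (Fin 2) :=
  Classical.epsilon fun w : FreeLieAlgebra K (Fin 2) => lieToFree K w = bchPoly K n

/-- The BCH product `a • b = log (e^a e^b) = ∑ n, w_n(a, b)`. -/
noncomputable def bch {L : Type*} [LieRing L] [LieAlgebra K L] (a b : L) : L :=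
  Classical.epsilon fun c =>
    LCSHasSum K (fun n : ℕ => FreeLieAlgebra.lift K ![a, b] (bchLie K n)) c

/-- The iterated BCH product `x₁ • (x₂ • (⋯ • x_k))` of a list. -/
noncomputable def bchProd {L : Type*} [LieRing L] [LieAlgebra K L] : List L → L
  | [] => 0
  | [x] => x
  | x :: y :: l => bch K x (bchProd (y :: l))

end BCH

/-! ### Planar binary rooted trees with labelled leaves -/

/-- A finite planar binary rooted tree with a labelling of its leaves by `A`. -/
inductive BTree (A : Type*) where
  | leaf (a : A) : BTree A
  | node (l r : BTree A) : BTree A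

namespace BTree

variable {A : Type*}

/-- A vertex is given by the path to it from the root: `false` is a step along a left edge,
`true` a step along a right edge. So `u → v` (the vertex `v` is on the path from `u` to the root)
means that `v` is a prefix of `u`, written `v <+: u`. This is the set of leaves. -/
def leaves : BTree A → Finset (List Bool)
  | leaf _ => {[]}
  | node l r => (leaves l).image (List.cons false) ∪ (leaves r).image (List.cons true)

/-- The set of internal vertices. -/
def internal : BTree A → Finset (List Bool)
  | leaf _ => ∅
  | node l r =>
      insert [] ((internal l).image (List.cons false) ∪ (internal r).image (List.cons true))

/-- The label of a leaf (`none` where the path is not a leaf of the tree). -/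
def label : BTree A → List Bool → Option A
  | leaf a, [] => some a
  | node l _, false :: p => label l p
  | node _ r, true :: p => label r p
  | _, _ => none

/-- The number of leaves. -/
def numLeaves (t : BTree A) : ℕ := t.leaves.card

/-- The subroots: the internal vertices that are not reached along a right edge, that is, the
top vertices of the non trivial rightmost branches. -/
def subroots (t : BTree A) : Finset (List Bool) :=
  t.internal.filter fun v => v.getLast? ≠ some true

/-- `d(v)`: the distance from the vertex `v` to the leaf at the end of its rightmost branch. -/
def dist : BTree A → List Bool → ℕ
  | leaf _, _ => 0
  | node _ r, [] => dist r [] + 1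
  | node l _, false :: p => dist l p
  | node _ r, true :: p => dist r p

/-- `m(v)`: the leaf at the end of the rightmost branch that contains `v`. -/
def rmLeaf (t : BTree A) (v : List Bool) : List Bool :=
  v ++ List.replicate (t.dist v) true

/-- The partial order `l₁ ≼ l₂` on leaves. -/
def LeafLE (t : BTree A) (l₁ l₂ : List Bool) : Prop :=
  l₁ = l₂ ∨ ∃ v ∈ t.subroots, l₂ = t.rmLeaf v ∧ v <+: l₁

/-- The labelled tree is posetted: its labelling is monotone for `≼`. -/
def IsPosetted [LE A] (t : BTree A) : Prop :=
  ∀ l₁ ∈ t.leaves, ∀ l₂ ∈ t.leaves, t.LeafLE l₁ l₂ →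
    ∀ x y : A, t.label l₁ = some x → t.label l₂ = some y → x ≤ y

/-- `t(v)`: the number of leaves below `v` with the same label as `m(v)`. -/
def mult [DecidableEq A] (t : BTree A) (v : List Bool) : ℕ :=
  (t.leaves.filter fun u => v <+: u ∧ t.label u = t.label (t.rmLeaf v)).card

/-- The coefficient `b_n` of `x ^ n` in `x / (e^x - 1)`, that is `B_n / n!`. -/
def bernCoeff (n : ℕ) : ℚ := bernoulli n / n !

theorem bernCoeff_generating :
    (PowerSeries.mk bernCoeff) * (PowerSeries.exp ℚ - 1) = PowerSeries.X := by
  have h := bernoulliPowerSeries_mul_exp_sub_one ℚ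
  have e : PowerSeries.mk bernCoeff = bernoulliPowerSeries ℚ := by
    ext n
    simp [bernoulliPowerSeries, bernCoeff]
  rw [e, h]

/-- The coefficient of a posetted tree: the product of `b_{d(v)} / t(v)` over the subroots. -/
def coeff [DecidableEq A] (t : BTree A) : ℚ :=
  ∏ v ∈ t.subroots, bernCoeff (t.dist v) / (t.mult v : ℚ)

/-- The iterated bracket `Z_Γ(f)`, where the leaf label `i` stands for the element `a i`. -/
def bracket {L : Type*} [LieRing L] (a : A → L) : BTree A → L
  | leaf i => a i
  | node l r => ⁅bracket a l, bracket a r⁆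

theorem numLeaves_leaf (a : A) : (leaf a).numLeaves = 1 := by
  simp [numLeaves, leaves]

theorem numLeaves_node (l r : BTree A) :
    (node l r).numLeaves = l.numLeaves + r.numLeaves := by
  unfold numLeaves
  rw [leaves, Finset.card_union_of_disjoint, Finset.card_image_of_injective,
    Finset.card_image_of_injective]
  · exact List.cons_injective
  · exact List.cons_injective
  · simp [Finset.disjoint_left]

theorem numLeaves_pos (t : BTree A) : 0 < t.numLeaves := by
  induction t with
  | leaf a => simp [numLeaves_leaf]
  | node l r hl hr => rw [numLeaves_node]; omega

theorem finite_numLeaves_le [Finite A] (n : ℕ) : {t : BTree A | t.numLeaves ≤ n}.Finite := by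
  induction n with
  | zero =>
    refine Set.finite_empty.subset fun t ht => ?_
    have := t.numLeaves_pos
    have h' : t.numLeaves ≤ 0 := ht
    omega
  | succ n ih =>
    refine ((Set.finite_range leaf).union (ih.image2 node ih)).subset fun t ht => ?_
    replace ht : t.numLeaves ≤ n + 1 := ht
    cases t with
    | leaf a => exact Or.inl ⟨a, rfl⟩
    | node l r =>
      rw [numLeaves_node] at ht
      have h₁ := l.numLeaves_pos
      have h₂ := r.numLeaves_pos
      have h₃ : l.numLeaves ≤ n := by omega
      have h₄ : r.numLeaves ≤ n := by omega
      exact Or.inr ⟨l, h₃, r, h₄, rfl⟩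

theorem finite_posetted [Finite A] [LE A] (n : ℕ) :
    {t : BTree A | t.IsPosetted ∧ t.numLeaves = n}.Finite :=
  (finite_numLeaves_le n).subset fun _ ht => ht.2.le

end BTree

/-- The set of binary posetted trees with labels in `A`. -/
abbrev PosettedTree (A : Type*) [LE A] : Type _ := {t : BTree A // t.IsPosetted}

/-- The finite set of binary posetted trees with `n` leaves and labels in `A`. -/
noncomputable def posettedTrees (A : Type*) [Finite A] [LE A] (n : ℕ) : Finset (BTree A) :=
  (BTree.finite_posetted (A := A) n).toFinset

/-! The heart is a differential equation. Let `e` be the greatest label and let Z(s) be the tree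
series in which every leaf labelled `e` carries a factor s. In a posetted tree the rightmost label
is the maximum, so `e` occurs exactly when the rightmost leaf carries it; d/ds then produces the
number of such leaves and cancels the factor 1/t at the root. Cutting along the rightmost branch
writes the tree as [l_1, [l_2, … [l_n, e]]] with arbitrary posetted l_i, whence Z' = ∑ b_n (ad Z)^n
(a_e) = (ad Z / (exp(ad Z) - 1))(a_e). By the formula for the derivative of an exponential this
means (exp Z)' = a_e exp Z, so exp Z(1) = exp(a_e) exp Z(0), and Z(0) is the series of the smaller
labels. Induction on the labels gives `truncExp_treeSum`. Everything takes place in associative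
algebras with a nilpotent filtration, where all series are finite sums.

Two facts transfer this to `L`. Applied to two labels, the expansion writes each component of
log(e^x e^y) as a sum of brackets, so the Lie polynomials w_n exist (`toFree_bchLie`). The Dynkin
map shows that a Lie polynomial whose associative image has only terms of degree greater than n lies
in the n-th term of the lower central series (`mem_lcs_of_toFree_mem`); this replaces injectivity of
the map to the free associative algebra, since `L` is separated. Hence elements of `L` represented
modulo every term by log(e^{x_1} ⋯ e^{x_k}) are unique (`IsLogProd.unique`), and both the tree sum
and the iterated product are of this kind. The alternating formula comes from e^{a_1} ⋯ e^{a_k}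
being inverse to e^{-a_k} ⋯ e^{-a_1}. -/

section PosettedTreeExpansion

attribute [local instance] LieRing.ofAssociativeRing

/-! ### The Dynkin map and the Euler derivation of the free Lie algebra. -/

namespace FreeLieAlgebra

section Dynkin

variable (K : Type*) [Field K] (X : Type*)

local notation "γ" => LieModule.lowerCentralSeries K (FreeLieAlgebra K X) (FreeLieAlgebra K X)

/-- The canonical Lie homomorphism from the free Lie algebra to the free associative algebra. -/
noncomputable def toFree : FreeLieAlgebra K X →ₗ⁅K⁆ FreeAlgebra K X :=
  FreeLieAlgebra.lift K (FreeAlgebra.ι K)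

@[simp] theorem toFree_of (x : X) : toFree K X (of K x) = FreeAlgebra.ι K x := by
  simp [toFree]

/-- The action of the free associative algebra on the free Lie algebra that extends the adjoint
action of the generators. -/
noncomputable def adFree : FreeAlgebra K X →ₐ[K] Module.End K (FreeLieAlgebra K X) :=
  FreeAlgebra.lift K fun x => LieAlgebra.ad K (FreeLieAlgebra K X) (of K x)

theorem adFree_toFree (p : FreeLieAlgebra K X) :
    adFree K X (toFree K X p) = LieAlgebra.ad K (FreeLieAlgebra K X) p := by
  have h : (adFree K X).toLieHom.comp (toFree K X) = LieAlgebra.ad K (FreeLieAlgebra K X) := by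
    refine hom_ext fun x => ?_
    simp [adFree]
  exact LieHom.congr_fun h p

/-- The free associative algebra acts on `FreeLieAlgebra K X × K`; a generator `x` sends `(p, c)` to
`([x, p] + c x, 0)`. -/
noncomputable def dynkinRep :
    FreeAlgebra K X →ₐ[K] Module.End K (FreeLieAlgebra K X × K) :=
  FreeAlgebra.lift K fun x =>
    LinearMap.prod
      (LinearMap.coprod (LieAlgebra.ad K (FreeLieAlgebra K X) (of K x))
        (LinearMap.toSpanSingleton K _ (of K x))) 0

/-- The Dynkin map `x₁ ⋯ x_n ↦ [x₁, [x₂, …, x_n]]`. -/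
noncomputable def dynkin : FreeAlgebra K X →ₗ[K] FreeLieAlgebra K X where
  toFun u := (dynkinRep K X u (0, 1)).1
  map_add' u v := by simp
  map_smul' c u := by simp

/-- The scalar coordinate records the constant term. Thanks to it `dynkin` is a component of a
representation, and its product rule is read off from multiplicativity. -/
theorem dynkinRep_apply (u : FreeAlgebra K X) (p : FreeLieAlgebra K X) (c : K) :
    dynkinRep K X u (p, c) =
      (adFree K X u p + c • dynkin K X u, c * FreeAlgebra.algebraMapInv u) := by
  induction u generalizing p c with
  | grade0 r => simp [dynkin, Algebra.algebraMap_eq_smul_one, mul_comm]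
  | grade1 x => simp [dynkin, dynkinRep, adFree, FreeAlgebra.algebraMapInv]
  | mul a b ha hb =>
    have h : dynkin K X (a * b) = (dynkinRep K X (a * b) (0, 1)).1 := rfl
    rw [h, map_mul, Module.End.mul_apply, Module.End.mul_apply, hb, ha, hb, ha]
    simp only [map_mul, Module.End.mul_apply, map_add, map_smul, map_zero, one_smul, zero_add,
      one_mul, smul_add, smul_smul, mul_assoc, Prod.mk.injEq]
    rw [mul_comm (FreeAlgebra.algebraMapInv b)]
    constructor
    · abel
    · ring
  | add a b ha hb =>
    rw [map_add, LinearMap.add_apply, ha, hb]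
    ext
    · simp; abel
    · simp [mul_add]

theorem dynkin_mul (u v : FreeAlgebra K X) :
    dynkin K X (u * v) =
      adFree K X u (dynkin K X v) + FreeAlgebra.algebraMapInv v • dynkin K X u := by
  have h : dynkin K X (u * v) = (dynkinRep K X (u * v) (0, 1)).1 := rfl
  rw [h, map_mul, Module.End.mul_apply, dynkinRep_apply K X v, dynkinRep_apply]
  simp

@[simp] theorem dynkin_ι (x : X) : dynkin K X (FreeAlgebra.ι K x) = of K x := by
  simp [dynkin, dynkinRep]

/-- The augmentation ideal of the free associative algebra. -/
noncomputable def augIdeal : Ideal (FreeAlgebra K X) :=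
  RingHom.ker (FreeAlgebra.algebraMapInv : FreeAlgebra K X →ₐ[K] K)

instance : (augIdeal K X).IsTwoSided := by unfold augIdeal; infer_instance

theorem mem_augIdeal {u : FreeAlgebra K X} :
    u ∈ augIdeal K X ↔ FreeAlgebra.algebraMapInv u = (0 : K) := Iff.rfl

theorem toFree_mem_augIdeal (p : FreeLieAlgebra K X) : toFree K X p ∈ augIdeal K X := by
  have h :
      (FreeAlgebra.algebraMapInv : FreeAlgebra K X →ₐ[K] K).toLieHom.comp (toFree K X) = 0 := by
    refine hom_ext fun x => ?_
    simp [FreeAlgebra.algebraMapInv]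
  exact LieHom.congr_fun h p

/-- The Dynkin map restricted to Lie polynomials. -/
noncomputable def euler : FreeLieAlgebra K X →ₗ[K] FreeLieAlgebra K X :=
  dynkin K X ∘ₗ (toFree K X : FreeLieAlgebra K X →ₗ[K] FreeAlgebra K X)

theorem euler_of (x : X) : euler K X (of K x) = of K x := by simp [euler]

/-- Lie elements have no constant term and act through `ad`, so the Dynkin map sends pq to [p, E q];
antisymmetrising gives a derivation. Being the identity on generators, it multiplies degree n by n
(Dynkin–Specht–Wever). -/
theorem euler_lie (p q : FreeLieAlgebra K X) :
    euler K X ⁅p, q⁆ = ⁅euler K X p, q⁆ + ⁅p, euler K X q⁆ := by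
  have hp := toFree_mem_augIdeal K X p
  have hq := toFree_mem_augIdeal K X q
  rw [mem_augIdeal] at hp hq
  simp only [euler, LinearMap.comp_apply, LieHom.coe_toLinearMap, LieHom.map_lie, Ring.lie_def,
    map_sub, dynkin_mul, hp, hq, adFree_toFree, zero_smul, add_zero, LieAlgebra.ad_apply]
  rw [← lie_skew q]
  abel

variable {K X}

theorem induction_lie {P : FreeLieAlgebra K X → Prop} (of : ∀ x, P (of K x))
    (zero : P 0) (add : ∀ p q, P p → P q → P (p + q)) (smul : ∀ (c : K) p, P p → P (c • p))
    (lie : ∀ p q, P p → P q → P ⁅p, q⁆) (p : FreeLieAlgebra K X) : P p := by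
  let S : LieSubalgebra K (FreeLieAlgebra K X) :=
    { carrier := {p | P p}
      add_mem' := fun {p q} hp hq => add p q hp hq
      zero_mem' := zero
      smul_mem' := fun c p hp => smul c p hp
      lie_mem' := fun {p q} hp hq => lie p q hp hq }
  -- By the universal property the identity factors through the subalgebra `S`.
  have h : S.incl.comp (FreeLieAlgebra.lift K fun x => (⟨_, of x⟩ : S)) = LieHom.id := by
    refine hom_ext fun x => ?_
    simp
  have := LieHom.congr_fun h p
  have h2 : p = ((FreeLieAlgebra.lift K fun x => (⟨_, of x⟩ : S)) p : FreeLieAlgebra K X) := by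
    simpa using this.symm
  rw [h2]
  exact (FreeLieAlgebra.lift K fun x => (⟨_, of x⟩ : S)) p |>.2

end Dynkin

end FreeLieAlgebra

/-! ### Brackets and the lower central series. -/

section LowerCentralSeries

variable {K L : Type*} [Field K] [LieRing L] [LieAlgebra K L]

local notation "γ" => LieModule.lowerCentralSeries K L L

theorem lie_mem_lcs_succ {n : ℕ} (x : L) {y : L} (hy : y ∈ γ n) : ⁅x, y⁆ ∈ γ (n + 1) := by
  rw [LieModule.lowerCentralSeries_succ]
  exact LieSubmodule.lie_mem_lie (LieSubmodule.mem_top x) hy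

theorem lcs_succ_induction {n : ℕ} {P : L → Prop} (zero : P 0)
    (add : ∀ x y, P x → P y → P (x + y))
    (lie : ∀ x : L, ∀ y ∈ γ n, P ⁅x, y⁆) {z : L} (hz : z ∈ γ (n + 1)) : P z := by
  rw [LieModule.lowerCentralSeries_succ, ← LieSubmodule.mem_toSubmodule,
    LieSubmodule.lieIdeal_oper_eq_linear_span'] at hz
  induction hz using Submodule.closure_induction with
  | zero => exact zero
  | add x y _ _ hx hy => exact add x y hx hy
  | smul_mem c x hx =>
    obtain ⟨u, -, v, hv, rfl⟩ := hx
    rw [← lie_smul]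
    exact lie _ _ ((γ n).smul_mem c hv)

/-- Induction through the Jacobi identity. The extra 1 comes from numbering: `γ m` is L^{m+1}. -/
theorem lie_mem_lcs_add {m n : ℕ} {x y : L} (hx : x ∈ γ m) (hy : y ∈ γ n) :
    ⁅x, y⁆ ∈ γ (m + n + 1) := by
  induction m generalizing x y n with
  | zero => simpa using lie_mem_lcs_succ x hy
  | succ m ih =>
    refine lcs_succ_induction (P := fun x => ⁅x, y⁆ ∈ γ (m + 1 + n + 1)) ?_ ?_ ?_ hx
    · simp
    · intro a b ha hb
      rw [add_lie]; exact add_mem ha hb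
    · intro a b hb
      rw [lie_lie]
      refine sub_mem ?_ ?_
      · have := lie_mem_lcs_succ a (ih hb hy)
        rwa [show m + 1 + n + 1 = m + n + 1 + 1 by ring]
      · have := ih hb (lie_mem_lcs_succ a hy)
        rwa [show m + 1 + n + 1 = m + (n + 1) + 1 by ring]

theorem lcs_antitone {m n : ℕ} (h : m ≤ n) {x : L} (hx : x ∈ γ n) : x ∈ γ m :=
  LieModule.antitone_lowerCentralSeries K L L h hx

theorem LieHom.map_mem_lcs {L' : Type*} [LieRing L'] [LieAlgebra K L'] (f : L →ₗ⁅K⁆ L') {n : ℕ}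
    {x : L} (hx : x ∈ γ n) : f x ∈ LieModule.lowerCentralSeries K L' L' n := by
  induction n generalizing x with
  | zero => simp
  | succ n ih =>
    refine lcs_succ_induction (P := fun x => f x ∈ LieModule.lowerCentralSeries K L' L' (n + 1))
      ?_ ?_ ?_ hx
    · simp
    · intro a b ha hb
      rw [map_add]; exact add_mem ha hb
    · intro a b hb
      rw [LieHom.map_lie]; exact lie_mem_lcs_succ _ (ih hb)

end LowerCentralSeries

/-! ### Degree and lower central series in the free Lie algebra. -/

namespace FreeLieAlgebra

variable {K : Type*} [Field K] {X : Type*}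

local notation "γ" => LieModule.lowerCentralSeries K (FreeLieAlgebra K X) (FreeLieAlgebra K X)

theorem euler_sub_mem_lcs_one (p : FreeLieAlgebra K X) : euler K X p - p ∈ γ 1 := by
  induction p using induction_lie with
  | of x => simp [euler_of]
  | zero => simp
  | add p q hp hq =>
    convert add_mem hp hq using 1
    simp only [map_add]; abel
  | smul c p hp =>
    convert (γ 1).smul_mem c hp using 1
    simp [smul_sub]
  | lie p q hp hq =>
    have h : ∀ a b : FreeLieAlgebra K X, ⁅a, b⁆ ∈ γ (0 + 1) := fun a b =>
      lie_mem_lcs_succ a (by simp)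
    rw [euler_lie]
    exact sub_mem (add_mem (h _ _) (h _ _)) (h _ _)

/-- The lowest terms of an element of `γ n` have degree n + 1, which is the eigenvalue of the Euler
derivation on the graded piece. -/
theorem euler_sub_mem (n : ℕ) {p : FreeLieAlgebra K X} (hp : p ∈ γ n) :
    euler K X p - ((n + 1 : ℕ) : K) • p ∈ γ (n + 1) := by
  induction n generalizing p with
  | zero => simpa using euler_sub_mem_lcs_one p
  | succ n ih =>
    refine lcs_succ_induction
      (P := fun p => euler K X p - ((n + 1 + 1 : ℕ) : K) • p ∈ γ (n + 1 + 1)) ?_ ?_ ?_ hp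
    · simp
    · intro p q hp hq
      convert add_mem hp hq using 1
      simp only [map_add, smul_add]; abel
    · intro p q hq
      have h1 := lie_mem_lcs_succ p (ih hq)
      have h2 := lie_mem_lcs_add (euler_sub_mem_lcs_one p) hq
      rw [show 1 + n + 1 = n + 1 + 1 by ring] at h2
      convert add_mem h1 h2 using 1
      simp only [euler_lie, lie_sub, sub_lie, lie_smul]
      push_cast
      module

/-- Each nonempty word acts by at least one bracket and so goes one step down the series; only the
constant term does not. -/
theorem adFree_sub_mem {n : ℕ} (u : FreeAlgebra K X) {p : FreeLieAlgebra K X} (hp : p ∈ γ n) :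
    adFree K X u p - FreeAlgebra.algebraMapInv (R := K) u • p ∈ γ (n + 1) := by
  induction u generalizing p with
  | grade0 r => simp [Algebra.algebraMap_eq_smul_one]
  | grade1 x =>
    simpa [adFree, FreeAlgebra.algebraMapInv] using lie_mem_lcs_succ (of K x) hp
  | mul a b ha hb =>
    have h1 := hb hp
    have h2 := ha (add_mem (lcs_antitone n.le_succ h1)
      ((γ n).smul_mem (FreeAlgebra.algebraMapInv (R := K) b) hp))
    rw [sub_add_cancel] at h2
    convert add_mem h2 ((γ (n + 1)).smul_mem (FreeAlgebra.algebraMapInv (R := K) a) h1) using 1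
    simp only [map_mul, Module.End.mul_apply, smul_sub, smul_smul]
    abel
  | add a b ha hb =>
    convert add_mem (ha hp) (hb hp) using 1
    simp only [map_add, LinearMap.add_apply, add_smul]
    abel

theorem dynkin_mem (n : ℕ) {u : FreeAlgebra K X} (hu : u ∈ augIdeal K X ^ (n + 1)) :
    dynkin K X u ∈ γ n := by
  induction n generalizing u with
  | zero => simp
  | succ n ih =>
    rw [Ideal.IsTwoSided.pow_succ] at hu
    induction hu using Submodule.mul_induction_on' with
    | mem_mul_mem a ha b hb =>
      have hb' : b ∈ augIdeal K X := by
        exact Ideal.pow_le_self (Nat.succ_ne_zero n) hb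
      rw [dynkin_mul, (mem_augIdeal K X).1 hb', zero_smul, add_zero]
      have := adFree_sub_mem a (ih hb)
      rwa [(mem_augIdeal K X).1 ha, zero_smul, sub_zero] at this
    | add a _ b _ ha hb => rw [map_add]; exact add_mem ha hb

/-- A Lie polynomial whose terms have degree greater than `n` is in the `n`-th term of the lower
central series. -/
theorem mem_lcs_of_toFree_mem [CharZero K] (n : ℕ) {p : FreeLieAlgebra K X}
    (hp : toFree K X p ∈ augIdeal K X ^ (n + 1)) : p ∈ γ n := by
  induction n with
  | zero => simp
  | succ n ih =>
    -- Modulo `γ (n + 1)` the element `euler p` is both (n + 1) p and 0; dividing by n + 1 uses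
    -- characteristic 0.
    have h1 := euler_sub_mem n (ih (Ideal.pow_le_pow_right (Nat.le_succ _) hp))
    have h2 : euler K X p ∈ γ (n + 1) := dynkin_mem (n + 1) hp
    have h3 := sub_mem h2 h1
    rw [sub_sub_cancel] at h3
    have hn : ((n + 1 : ℕ) : K) ≠ 0 := Nat.cast_ne_zero.2 (Nat.succ_ne_zero n)
    have h4 := (γ (n + 1)).smul_mem ((n + 1 : ℕ) : K)⁻¹ h3
    rwa [smul_smul, inv_mul_cancel₀ hn, one_smul] at h4

end FreeLieAlgebra

theorem Finset.sum_range_sum_antidiagonal {M : Type*} [AddCommMonoid M] (N : ℕ)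
    (c : ℕ × ℕ → M) (hc : ∀ i j, N ≤ i + j → c (i, j) = 0) :
    ∑ n ∈ Finset.range N, ∑ p ∈ Finset.HasAntidiagonal.antidiagonal n, c p =
      ∑ i ∈ Finset.range N, ∑ j ∈ Finset.range N, c (i, j) := by
  rw [Finset.sum_sigma', ← Finset.sum_product']
  refine Finset.sum_of_injOn (fun x => x.2) ?_ ?_ ?_ ?_
  · rintro ⟨n, i, j⟩ h ⟨n', i', j'⟩ h' he
    simp only [Finset.coe_sigma, Set.mem_sigma_iff, Finset.mem_coe,
      Finset.HasAntidiagonal.mem_antidiagonal] at h h'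
    simp only [Prod.mk.injEq] at he
    obtain ⟨rfl, rfl⟩ := he
    obtain ⟨-, rfl⟩ := h
    obtain ⟨-, rfl⟩ := h'
    rfl
  · rintro ⟨n, i, j⟩ h
    simp only [Finset.coe_sigma, Set.mem_sigma_iff, Finset.mem_coe,
      Finset.HasAntidiagonal.mem_antidiagonal, Finset.mem_range] at h
    simp only [Finset.coe_product, Set.mem_prod, Finset.mem_coe, Finset.mem_range]
    omega
  · rintro ⟨i, j⟩ - h
    refine hc i j ?_
    by_contra hlt
    push Not at hlt
    exact h ⟨⟨i + j, i, j⟩, by simp [hlt], rfl⟩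
  · intro x _
    rfl

/-! ### Truncated exponential and logarithm at nilpotent elements. -/

section TruncatedSeries

variable (K : Type*) [Field K]

/-- The truncated exponential series. -/
noncomputable def truncExp {Q : Type*} [Ring Q] [Algebra K Q] (N : ℕ) (z : Q) : Q :=
  ∑ i ∈ Finset.range (N + 1), ((i ! : K)⁻¹) • z ^ i

/-- The truncated logarithm series `∑ (-1) ^ (m - 1) / m (u - 1) ^ m`. -/
noncomputable def truncLog {Q : Type*} [Ring Q] [Algebra K Q] (N : ℕ) (u : Q) : Q :=
  ∑ m ∈ Finset.Icc 1 N, ((-1 : K) ^ (m - 1) / (m : K)) • (u - 1) ^ m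

variable {K}

theorem AlgHom.map_truncExp {Q Q' : Type*} [Ring Q] [Algebra K Q] [Ring Q'] [Algebra K Q']
    (f : Q →ₐ[K] Q') (N : ℕ) (z : Q) : f (truncExp K N z) = truncExp K N (f z) := by
  simp [truncExp]

theorem AlgHom.map_truncLog {Q Q' : Type*} [Ring Q] [Algebra K Q] [Ring Q'] [Algebra K Q']
    (f : Q →ₐ[K] Q') (N : ℕ) (z : Q) : f (truncLog K N z) = truncLog K N (f z) := by
  simp [truncLog]

theorem truncExp_zero {Q : Type*} [Ring Q] [Algebra K Q] (N : ℕ) :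
    truncExp K N (0 : Q) = 1 := by
  unfold truncExp
  rw [Finset.sum_range_succ']
  simp

/-- Evaluation of power series at a nilpotent element. -/
noncomputable def PowerSeries.nilEval {A : Type*} [Ring A] [Algebra K A] (z : A) (M : ℕ)
    (hz : z ^ M = 0) (hM : 0 < M) : PowerSeries K →ₐ[K] A :=
  AlgHom.ofLinearMap
    (∑ i ∈ Finset.range M, (LinearMap.toSpanSingleton K A (z ^ i)).comp (PowerSeries.coeff i))
    (by
      obtain ⟨M, rfl⟩ : ∃ m, M = m + 1 := ⟨M - 1, by omega⟩
      simp only [LinearMap.sum_apply, LinearMap.comp_apply, LinearMap.toSpanSingleton_apply]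
      rw [Finset.sum_range_succ']
      simp [PowerSeries.coeff_one])
    (by
      intro f g
      simp only [LinearMap.sum_apply, LinearMap.comp_apply, LinearMap.toSpanSingleton_apply]
      rw [Finset.sum_mul_sum, ← Finset.sum_range_sum_antidiagonal M
        fun p => PowerSeries.coeff p.1 f • z ^ p.1 * PowerSeries.coeff p.2 g • z ^ p.2]
      · refine Finset.sum_congr rfl fun n _ => ?_
        rw [PowerSeries.coeff_mul, Finset.sum_smul]
        refine Finset.sum_congr rfl fun p hp => ?_
        rw [smul_mul_smul_comm, ← pow_add, Finset.HasAntidiagonal.mem_antidiagonal.1 hp]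
      · intro i j h
        rw [smul_mul_smul_comm, ← pow_add, pow_eq_zero_of_le h hz, smul_zero])

theorem PowerSeries.nilEval_apply {A : Type*} [Ring A] [Algebra K A] (z : A) (M : ℕ)
    (hz : z ^ M = 0) (hM : 0 < M) (f : PowerSeries K) :
    PowerSeries.nilEval z M hz hM f =
      ∑ i ∈ Finset.range M, PowerSeries.coeff i f • z ^ i := by
  simp [PowerSeries.nilEval, LinearMap.sum_apply]

variable [CharZero K]

theorem PowerSeries.coeff_exp_eq_inv (n : ℕ) :
    PowerSeries.coeff n (PowerSeries.exp K) = (n ! : K)⁻¹ := by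
  rw [PowerSeries.coeff_exp]
  simp

theorem PowerSeries.nilEval_exp {A : Type*} [Ring A] [Algebra K A] (z : A) (N : ℕ)
    (hz : z ^ (N + 1) = 0) :
    PowerSeries.nilEval z (N + 1) hz N.succ_pos (PowerSeries.exp K) = truncExp K N z := by
  rw [PowerSeries.nilEval_apply]
  simp only [PowerSeries.coeff_exp_eq_inv, truncExp]

theorem truncExp_neg_mul {A : Type*} [Ring A] [Algebra K A] {z : A} {N : ℕ}
    (hz : z ^ (N + 1) = 0) : truncExp K N (-z) * truncExp K N z = 1 := by
  have h := congrArg (PowerSeries.nilEval z (N + 1) hz N.succ_pos)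
    ((mul_comm _ _).trans (PowerSeries.exp_mul_exp_neg_eq_one (A := K)))
  rw [map_mul, map_one, PowerSeries.nilEval_exp, PowerSeries.nilEval_apply] at h
  rw [← h, truncExp]
  congr 1
  refine Finset.sum_congr rfl fun i _ => ?_
  rw [PowerSeries.evalNegHom, PowerSeries.coeff_rescale, PowerSeries.coeff_exp_eq_inv, neg_pow z]
  rcases Nat.even_or_odd i with h | h <;> simp [h.neg_one_pow]

theorem sum_Icc_neg_pow_mul {R : Type*} [CommRing R] (u : R) (N : ℕ) :
    ∑ m ∈ Finset.Icc 1 N, (-u) ^ (m - 1) * (1 + u) = 1 - (-u) ^ N := by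
  induction N with
  | zero => simp
  | succ N ih =>
    rw [Finset.sum_Icc_succ_top (by omega), ih, Nat.add_sub_cancel]
    ring

/-- The truncated series `log (exp X)` agrees with `X` up to degree `N`. -/
theorem coeff_truncLog_exp {N n : ℕ} (hn : n ≤ N) :
    PowerSeries.coeff n (truncLog K N (PowerSeries.exp K)) =
      PowerSeries.coeff n (PowerSeries.X : PowerSeries K) := by
  set u : PowerSeries K := PowerSeries.exp K - 1 with hu
  -- Since u' = 1 + u, differentiating the truncated log(1 + u) gives a telescoping geometric sum.
  -- As X divides u, the result agrees with X' = 1 below degree N.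
  have hD : PowerSeries.derivative K (truncLog K N (PowerSeries.exp K)) = 1 - (-u) ^ N := by
    have h1 : PowerSeries.derivative K u = 1 + u := by
      rw [hu]; simp [PowerSeries.derivative_exp]
    rw [← sum_Icc_neg_pow_mul, truncLog, map_sum]
    refine Finset.sum_congr rfl fun m hm => ?_
    have hm0 : (m : K) ≠ 0 := Nat.cast_ne_zero.2 (by have := (Finset.mem_Icc.1 hm).1; omega)
    have h3 : (m : PowerSeries K) = PowerSeries.C (m : K) := by simp
    rw [Derivation.map_smul, PowerSeries.derivative_pow, ← hu, h1, PowerSeries.smul_eq_C_mul,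
      neg_pow u, h3, ← mul_assoc, ← mul_assoc, ← map_mul, div_mul_cancel₀ _ hm0, map_pow, map_neg,
      map_one]
  have hX : (PowerSeries.X : PowerSeries K) ∣ u := by
    rw [PowerSeries.X_dvd_iff, hu]; simp
  cases n with
  | zero =>
    have : ∀ m ∈ Finset.Icc 1 N, PowerSeries.constantCoeff
        (((-1 : K) ^ (m - 1) / (m : K)) • u ^ m) = 0 := by
      intro m hm
      have hm0 : m ≠ 0 := by have := (Finset.mem_Icc.1 hm).1; omega
      rw [PowerSeries.smul_eq_C_mul, map_mul, map_pow, PowerSeries.X_dvd_iff.1 hX, zero_pow hm0,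
        mul_zero]
    rw [PowerSeries.coeff_zero_eq_constantCoeff, PowerSeries.constantCoeff_X, truncLog, map_sum]
    exact Finset.sum_eq_zero this
  | succ n =>
    have h1 := PowerSeries.coeff_derivative (truncLog K N (PowerSeries.exp K)) n
    have h2 : PowerSeries.coeff n ((-u) ^ N) = 0 :=
      PowerSeries.X_pow_dvd_iff.1 (pow_dvd_pow_of_dvd ((dvd_neg).2 hX) N) n hn
    have h4 := PowerSeries.coeff_derivative (PowerSeries.X : PowerSeries K) n
    have hn0 : (n + 1 : K) ≠ 0 := by exact_mod_cast Nat.succ_ne_zero n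
    rw [hD, map_sub, h2, sub_zero] at h1
    rw [PowerSeries.derivative_X] at h4
    exact mul_right_cancel₀ hn0 (h1.symm.trans h4)

theorem truncLog_truncExp {A : Type*} [Ring A] [Algebra K A] {z : A} {N : ℕ}
    (hz : z ^ (N + 1) = 0) : truncLog K N (truncExp K N z) = z := by
  rw [← PowerSeries.nilEval_exp z N hz, ← AlgHom.map_truncLog, PowerSeries.nilEval_apply,
    Finset.sum_congr rfl fun i hi => by
      rw [coeff_truncLog_exp (Nat.lt_succ_iff.1 (Finset.mem_range.1 hi))],
    ← PowerSeries.nilEval_apply z _ hz N.succ_pos, PowerSeries.nilEval_apply]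
  -- For N = 0 the sum has no linear term, but then the hypothesis says z = 0.
  rcases N with _ | N
  · simpa using hz.symm
  · rw [Finset.sum_eq_single 1]
    · simp
    · intro b _ hb
      simp [PowerSeries.coeff_X, hb]
    · intro h
      simp at h

end TruncatedSeries

/-! ### Nilpotent filtrations and evaluation of the BCH polynomials. -/

section NilFiltration

/-- A multiplicative filtration of an algebra that vanishes from step `N + 1` on. -/
structure IsNilFiltration {K Q : Type*} [Field K] [Ring Q] [Algebra K Q] (F : ℕ → Submodule K Q)
    (N : ℕ) : Prop where
  zero_eq_top : F 0 = ⊤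
  anti : Antitone F
  mul_mem : ∀ {m n : ℕ} {x y : Q}, x ∈ F m → y ∈ F n → x * y ∈ F (m + n)
  eq_bot : F (N + 1) = ⊥

variable {K Q : Type*} [Field K] [Ring Q] [Algebra K Q] {F : ℕ → Submodule K Q} {N : ℕ}

namespace IsNilFiltration

variable (hF : IsNilFiltration F N)
include hF

theorem eq_zero_of_mem {n : ℕ} (hn : N < n) {x : Q} (hx : x ∈ F n) : x = 0 := by
  have := hF.anti (Nat.succ_le_of_lt hn) hx
  rwa [hF.eq_bot, Submodule.mem_bot] at this

theorem mem_zero (x : Q) : x ∈ F 0 := by rw [hF.zero_eq_top]; trivial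

theorem pow_mem {x : Q} {m : ℕ} (hx : x ∈ F m) (n : ℕ) : x ^ n ∈ F (m * n) := by
  induction n with
  | zero => simpa using hF.mem_zero 1
  | succ n ih => rw [pow_succ, mul_add, mul_one]; exact hF.mul_mem ih hx

theorem pow_eq_zero {x : Q} (hx : x ∈ F 1) : x ^ (N + 1) = 0 :=
  hF.eq_zero_of_mem N.lt_succ_self (by simpa using hF.pow_mem hx (N + 1))

theorem lie_mem {m n : ℕ} {x y : Q} (hx : x ∈ F m) (hy : y ∈ F n) : ⁅x, y⁆ ∈ F (m + n) := by
  rw [Ring.lie_def]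
  exact sub_mem (hF.mul_mem hx hy) (by rw [add_comm]; exact hF.mul_mem hy hx)

end IsNilFiltration

section BCHEvaluation

theorem AlgHom.map_logCoeff {R R' : Type*} [Ring R] [Algebra K R] [Ring R'] [Algebra K R']
    (f : R →ₐ[K] R') (E : PowerSeries R) (n : ℕ) :
    f (logCoeff K E n) = logCoeff K (PowerSeries.map (f : R →+* R') E) n := by
  simp only [logCoeff, map_sum, map_smul]
  refine Finset.sum_congr rfl fun m _ => ?_
  congr 1
  rw [← map_one (PowerSeries.map (f : R →+* R')), ← map_sub, ← map_pow, PowerSeries.coeff_map]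
  rfl

theorem AlgHom.map_expSeries {R R' : Type*} [Ring R] [Algebra K R] [Ring R'] [Algebra K R']
    (f : R →ₐ[K] R') (x : R) :
    PowerSeries.map (f : R →+* R') (expSeries K x) = expSeries K (f x) := by
  ext n
  simp [expSeries]

theorem lift_bchPoly {R : Type*} [Ring R] [Algebra K R] (f : Fin 2 → R) (n : ℕ) :
    FreeAlgebra.lift K f (bchPoly K n) = logCoeff K (expSeries K (f 0) * expSeries K (f 1)) n := by
  rw [bchPoly, AlgHom.map_logCoeff, map_mul, AlgHom.map_expSeries, AlgHom.map_expSeries]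
  simp

theorem PowerSeries.coeff_pow_eq_zero_of_lt {R : Type*} [Ring R] {f : PowerSeries R}
    (hf : PowerSeries.coeff 0 f = 0) {n m : ℕ} (h : n < m) : PowerSeries.coeff n (f ^ m) = 0 := by
  induction m generalizing n with
  | zero => omega
  | succ m ih =>
    rw [pow_succ, PowerSeries.coeff_mul]
    refine Finset.sum_eq_zero fun p hp => ?_
    rw [Finset.HasAntidiagonal.mem_antidiagonal] at hp
    rcases Nat.eq_zero_or_pos p.2 with h0 | h0
    · rw [h0, hf, mul_zero]
    · rw [ih (by omega), zero_mul]

namespace IsNilFiltration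

variable (hF : IsNilFiltration F N)
include hF

theorem coeff_mul_mem {f g : PowerSeries Q} (hf : ∀ n, PowerSeries.coeff n f ∈ F n)
    (hg : ∀ n, PowerSeries.coeff n g ∈ F n) (n : ℕ) : PowerSeries.coeff n (f * g) ∈ F n := by
  rw [PowerSeries.coeff_mul]
  refine sum_mem fun p hp => ?_
  rw [← Finset.HasAntidiagonal.mem_antidiagonal.1 hp]
  exact hF.mul_mem (hf _) (hg _)

theorem coeff_one_mem (n : ℕ) : PowerSeries.coeff n (1 : PowerSeries Q) ∈ F n := by
  rw [PowerSeries.coeff_one]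
  split_ifs with h
  · rw [h]; exact hF.mem_zero 1
  · exact zero_mem _

/-- This is substitution of T = 1: coefficients beyond N vanish by the filtration, so on such series
it is a finite sum and multiplicative. -/
theorem sum_coeff_mul {f g : PowerSeries Q} (hf : ∀ n, PowerSeries.coeff n f ∈ F n)
    (hg : ∀ n, PowerSeries.coeff n g ∈ F n) :
    ∑ n ∈ Finset.range (N + 1), PowerSeries.coeff n (f * g) =
      (∑ n ∈ Finset.range (N + 1), PowerSeries.coeff n f) *
        ∑ n ∈ Finset.range (N + 1), PowerSeries.coeff n g := by
  simp only [PowerSeries.coeff_mul]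
  rw [Finset.sum_range_sum_antidiagonal (N + 1)
    (fun p => PowerSeries.coeff p.1 f * PowerSeries.coeff p.2 g), Finset.sum_mul_sum]
  exact fun i j h => hF.eq_zero_of_mem h (hF.mul_mem (hf i) (hg j))

theorem coeff_pow_mem {f : PowerSeries Q} (hf : ∀ n, PowerSeries.coeff n f ∈ F n) (m n : ℕ) :
    PowerSeries.coeff n (f ^ m) ∈ F n := by
  induction m generalizing n with
  | zero => rw [pow_zero]; exact hF.coeff_one_mem n
  | succ m ih => rw [pow_succ]; exact hF.coeff_mul_mem ih hf n

theorem sum_coeff_pow {f : PowerSeries Q} (hf : ∀ n, PowerSeries.coeff n f ∈ F n) (m : ℕ) :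
    ∑ n ∈ Finset.range (N + 1), PowerSeries.coeff n (f ^ m) =
      (∑ n ∈ Finset.range (N + 1), PowerSeries.coeff n f) ^ m := by
  induction m with
  | zero => simp [PowerSeries.coeff_one]
  | succ m ih => rw [pow_succ, pow_succ, hF.sum_coeff_mul (hF.coeff_pow_mem hf m) hf, ih]

theorem coeff_expSeries_mem {x : Q} (hx : x ∈ F 1) (n : ℕ) :
    PowerSeries.coeff n (expSeries K x) ∈ F n := by
  rw [expSeries, PowerSeries.coeff_mk]
  exact (F n).smul_mem _ (by simpa using hF.pow_mem hx n)

theorem sum_logCoeff {E : PowerSeries Q} (hE : ∀ n, PowerSeries.coeff n E ∈ F n)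
    (hE0 : PowerSeries.coeff 0 E = 1) :
    ∑ n ∈ Finset.range (N + 1), logCoeff K E n =
      truncLog K N (∑ n ∈ Finset.range (N + 1), PowerSeries.coeff n E) := by
  -- The cut-off m ≤ n is raised to the common bound N: E - 1 has no constant term, so the added
  -- powers do not reach degree n.
  have h1 : ∀ n ∈ Finset.range (N + 1), logCoeff K E n = ∑ m ∈ Finset.Icc 1 N,
      ((-1 : K) ^ (m - 1) / (m : K)) • PowerSeries.coeff n ((E - 1) ^ m) := by
    intro n hn
    refine Finset.sum_subset
      (Finset.Icc_subset_Icc_right (Nat.lt_succ_iff.1 (Finset.mem_range.1 hn))) ?_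
    intro m hm hmn
    rw [PowerSeries.coeff_pow_eq_zero_of_lt, smul_zero]
    · rw [map_sub, hE0, PowerSeries.coeff_one, if_pos rfl, sub_self]
    · simp only [Finset.mem_Icc] at hm hmn
      omega
  have h2 : ∀ n, PowerSeries.coeff n (E - 1) ∈ F n := fun n => by
    rw [map_sub]
    exact sub_mem (hE n) (hF.coeff_one_mem n)
  rw [Finset.sum_congr rfl h1, Finset.sum_comm, truncLog]
  refine Finset.sum_congr rfl fun m _ => ?_
  rw [← Finset.smul_sum, hF.sum_coeff_pow h2]
  simp [PowerSeries.coeff_one]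

theorem sum_lift_bchPoly {x y : Q} (hx : x ∈ F 1) (hy : y ∈ F 1) :
    ∑ n ∈ Finset.range (N + 1), FreeAlgebra.lift K ![x, y] (bchPoly K n) =
      truncLog K N (truncExp K N x * truncExp K N y) := by
  simp only [lift_bchPoly]
  rw [hF.sum_logCoeff]
  · rw [hF.sum_coeff_mul]
    · simp [expSeries, truncExp]
    · exact fun n => hF.coeff_expSeries_mem hx n
    · exact fun n => hF.coeff_expSeries_mem hy n
  · exact hF.coeff_mul_mem (fun n => hF.coeff_expSeries_mem hx n)
      (fun n => hF.coeff_expSeries_mem hy n)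
  · simp [PowerSeries.coeff_mul, expSeries]

end IsNilFiltration

end BCHEvaluation

section QuotientFiltration

variable (K) {P : Type*} [Ring P] [Algebra K P] (I : Ideal P) [I.IsTwoSided]

/-- The filtration of `P ⧸ I ^ (N + 1)` by the images of the powers of `I`. -/
def quotFiltration (N n : ℕ) : Submodule K (P ⧸ I ^ (N + 1)) :=
  ((I ^ n).restrictScalars K).map (Ideal.Quotient.mkₐ K (I ^ (N + 1))).toLinearMap

theorem isNilFiltration_quotFiltration (N : ℕ) : IsNilFiltration (quotFiltration K I N) N where
  zero_eq_top := by
    rw [eq_top_iff]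
    intro x _
    obtain ⟨x, rfl⟩ := Ideal.Quotient.mk_surjective x
    exact ⟨x, by simp [Ideal.one_eq_top, Submodule.pow_zero], rfl⟩
  anti := by
    intro m n h
    exact Submodule.map_mono fun x hx => Ideal.pow_le_pow_right h hx
  mul_mem := by
    rintro m n _ _ ⟨x, hx, rfl⟩ ⟨y, hy, rfl⟩
    refine ⟨x * y, ?_, by simp⟩
    have := Ideal.mul_mem_mul hx hy
    rw [← Ideal.IsTwoSided.pow_add] at this
    exact this
  eq_bot := by
    rw [eq_bot_iff]
    rintro _ ⟨x, hx, rfl⟩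
    exact Ideal.Quotient.eq_zero_iff_mem.2 hx

theorem mk_mem_quotFiltration (N : ℕ) {n : ℕ} {x : P} (hx : x ∈ I ^ n) :
    Ideal.Quotient.mkₐ K (I ^ (N + 1)) x ∈ quotFiltration K I N n := ⟨x, hx, rfl⟩

end QuotientFiltration

end NilFiltration

/-! ### Recursive forms of posettedness and of the tree coefficient. -/

namespace BTree

variable {A : Type*}

/-- The labels of the leaves, from left to right. -/
def labels : BTree A → List A
  | leaf a => [a]
  | node l r => labels l ++ labels r

/-- The label of the rightmost leaf. -/
def rlabel : BTree A → A
  | leaf a => a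
  | node _ r => rlabel r

/-- The product of the factors of the subroots other than the root. -/
def coeffTail [DecidableEq A] : BTree A → ℚ
  | leaf _ => 1
  | node l r => l.coeff * coeffTail r

theorem rlabel_mem_labels (t : BTree A) : t.rlabel ∈ t.labels := by
  induction t with
  | leaf a => simp [labels, rlabel]
  | node l r _ hr => simp [labels, rlabel, hr]

theorem dist_nil_lt_numLeaves (t : BTree A) : t.dist [] < t.numLeaves := by
  induction t with
  | leaf a => simp [dist, numLeaves_leaf]
  | node l r _ hr =>
    have := l.numLeaves_pos
    rw [numLeaves_node, dist]
    omega

theorem mem_leaves_node {l r : BTree A} {u : List Bool} :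
    u ∈ (node l r).leaves ↔ (∃ p ∈ l.leaves, false :: p = u) ∨ ∃ p ∈ r.leaves, true :: p = u := by
  simp [leaves]

theorem label_rmLeaf_nil (t : BTree A) : t.label (t.rmLeaf []) = some t.rlabel := by
  induction t with
  | leaf a => simp [rmLeaf, dist, label, rlabel]
  | node l r _ hr => simpa [rmLeaf, dist, label, rlabel, List.replicate_succ] using hr

theorem rmLeaf_nil_mem_leaves (t : BTree A) : t.rmLeaf [] ∈ t.leaves := by
  induction t with
  | leaf a => simp [rmLeaf, dist, leaves]
  | node l r _ hr => simpa [rmLeaf, dist, leaves, List.replicate_succ] using hr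

theorem mem_labels_iff {t : BTree A} {x : A} :
    x ∈ t.labels ↔ ∃ u ∈ t.leaves, t.label u = some x := by
  induction t with
  | leaf a => simp [labels, leaves, label, eq_comm]
  | node l r hl hr =>
    simp only [labels, List.mem_append, hl, hr, mem_leaves_node]
    constructor
    · rintro (⟨u, hu, h⟩ | ⟨u, hu, h⟩)
      · exact ⟨_, Or.inl ⟨u, hu, rfl⟩, h⟩
      · exact ⟨_, Or.inr ⟨u, hu, rfl⟩, h⟩
    · rintro ⟨_, (⟨u, hu, rfl⟩ | ⟨u, hu, rfl⟩), h⟩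
      · exact Or.inl ⟨u, hu, h⟩
      · exact Or.inr ⟨u, hu, h⟩

theorem rmLeaf_cons_false (l r : BTree A) (v : List Bool) :
    (node l r).rmLeaf (false :: v) = false :: l.rmLeaf v := rfl

theorem rmLeaf_cons_true (l r : BTree A) (v : List Bool) :
    (node l r).rmLeaf (true :: v) = true :: r.rmLeaf v := rfl

theorem getLast?_cons_ne {b : Bool} {v : List Bool} :
    (b :: v).getLast? ≠ some true ↔ v.getLast? ≠ some true ∧ (v = [] → b = false) := by
  cases v with
  | nil => cases b <;> simp
  | cons c v => simp

theorem mem_subroots_node {l r : BTree A} {v : List Bool} :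
    v ∈ (node l r).subroots ↔ v = [] ∨ (∃ p ∈ l.subroots, false :: p = v) ∨
      ∃ p ∈ r.subroots, p ≠ [] ∧ true :: p = v := by
  simp only [subroots, internal, Finset.mem_filter, Finset.mem_insert, Finset.mem_union,
    Finset.mem_image]
  constructor
  · rintro ⟨rfl | ⟨p, hp, rfl⟩ | ⟨p, hp, rfl⟩, h⟩
    · exact Or.inl rfl
    · rw [getLast?_cons_ne] at h
      exact Or.inr (Or.inl ⟨p, ⟨hp, h.1⟩, rfl⟩)
    · rw [getLast?_cons_ne] at h
      exact Or.inr (Or.inr ⟨p, ⟨hp, h.1⟩, fun h' => by simpa using h.2 h', rfl⟩)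
  · rintro (rfl | ⟨p, ⟨hp, h⟩, rfl⟩ | ⟨p, ⟨hp, h⟩, h0, rfl⟩)
    · simp
    · exact ⟨Or.inr (Or.inl ⟨p, hp, rfl⟩), getLast?_cons_ne.2 ⟨h, fun _ => rfl⟩⟩
    · exact ⟨Or.inr (Or.inr ⟨p, hp, rfl⟩), getLast?_cons_ne.2 ⟨h, fun h' => absurd h' h0⟩⟩

theorem subroots_leaf (a : A) : (leaf a).subroots = ∅ := by simp [subroots, internal]

theorem LeafLE.of_left {l r : BTree A} {u v : List Bool} (h : l.LeafLE u v) :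
    (node l r).LeafLE (false :: u) (false :: v) := by
  rcases h with rfl | ⟨w, hw, rfl, h⟩
  · exact Or.inl rfl
  · exact Or.inr ⟨false :: w, mem_subroots_node.2 (Or.inr (Or.inl ⟨w, hw, rfl⟩)), rfl, by simpa⟩

theorem isPosetted_leaf [Preorder A] (a : A) : (leaf a).IsPosetted := by
  intro l₁ h₁ l₂ h₂ _ x y hx hy
  simp only [leaves, Finset.mem_singleton] at h₁ h₂
  subst h₁ h₂
  simp only [label, Option.some.injEq] at hx hy
  exact (hx.symm.trans hy).le

theorem IsPosetted.le_rlabel [Preorder A] {t : BTree A} (ht : t.IsPosetted) {x : A}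
    (hx : x ∈ t.labels) : x ≤ t.rlabel := by
  cases t with
  | leaf a => simp only [labels, List.mem_singleton] at hx; exact hx.le
  | node l r =>
    obtain ⟨u, hu, hx⟩ := mem_labels_iff.1 hx
    exact ht u hu _ (rmLeaf_nil_mem_leaves _)
      (Or.inr ⟨[], mem_subroots_node.2 (Or.inl rfl), rfl, List.nil_prefix⟩) _ _ hx
      (label_rmLeaf_nil _)

/-- The right child ceases to be a subroot once it is grafted, but its condition is contained in
that of the new root, which has the same rightmost leaf. -/
theorem isPosetted_node [Preorder A] {l r : BTree A} :
    (node l r).IsPosetted ↔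
      l.IsPosetted ∧ r.IsPosetted ∧ ∀ x ∈ l.labels, x ≤ r.rlabel := by
  constructor
  · intro h
    have hle : ∀ x ∈ l.labels ++ r.labels, x ≤ r.rlabel := fun x hx => h.le_rlabel hx
    refine ⟨?_, ?_, fun x hx => hle x (List.mem_append_left _ hx)⟩
    · intro u hu v hv huv x y hx hy
      exact h _ (mem_leaves_node.2 (Or.inl ⟨u, hu, rfl⟩)) _
        (mem_leaves_node.2 (Or.inl ⟨v, hv, rfl⟩)) huv.of_left x y hx hy
    · intro u hu v hv huv x y hx hy
      rcases huv with rfl | ⟨w, hw, rfl, huw⟩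
      · rw [hx] at hy; exact (Option.some.inj hy).le
      rcases eq_or_ne w [] with rfl | hw0
      · rw [label_rmLeaf_nil] at hy
        rw [← Option.some.inj hy]
        exact hle x (List.mem_append_right _ (mem_labels_iff.2 ⟨u, hu, hx⟩))
      · exact h _ (mem_leaves_node.2 (Or.inr ⟨u, hu, rfl⟩)) _
          (mem_leaves_node.2 (Or.inr ⟨_, hv, rfl⟩))
          (Or.inr ⟨true :: w, mem_subroots_node.2 (Or.inr (Or.inr ⟨w, hw, hw0, rfl⟩)), rfl,
            by simpa⟩) x y hx hy
  · rintro ⟨hl, hr, hlr⟩ u hu v hv (rfl | ⟨w, hw, rfl, huw⟩) x y hx hy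
    · rw [hx] at hy; exact (Option.some.inj hy).le
    rcases mem_subroots_node.1 hw with rfl | ⟨p, hp, rfl⟩ | ⟨p, hp, hp0, rfl⟩
    · rw [label_rmLeaf_nil] at hy
      rw [← Option.some.inj hy]
      have hx' : x ∈ (node l r).labels := mem_labels_iff.2 ⟨u, hu, hx⟩
      rcases List.mem_append.1 hx' with h | h
      · exact hlr x h
      · exact hr.le_rlabel h
    · rcases mem_leaves_node.1 hu with ⟨q, hq, rfl⟩ | ⟨q, hq, rfl⟩
      · rw [rmLeaf_cons_false] at hv hy
        have hv' : l.rmLeaf p ∈ l.leaves := by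
          rcases mem_leaves_node.1 hv with ⟨q', hq', h⟩ | ⟨q', hq', h⟩
          · rwa [← (List.cons.inj h).2]
          · simp at h
        exact hl q hq _ hv' (Or.inr ⟨p, hp, rfl, by simpa using huw⟩) x y hx hy
      · simp at huw
    · rcases mem_leaves_node.1 hu with ⟨q, hq, rfl⟩ | ⟨q, hq, rfl⟩
      · simp at huw
      · rw [rmLeaf_cons_true] at hv hy
        have hv' : r.rmLeaf p ∈ r.leaves := by
          rcases mem_leaves_node.1 hv with ⟨q', hq', h⟩ | ⟨q', hq', h⟩
          · simp at h
          · rwa [← (List.cons.inj h).2]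
        exact hr q hq _ hv' (Or.inr ⟨p, hp, rfl, by simpa using huw⟩) x y hx hy

theorem subroots_node (l r : BTree A) : (node l r).subroots.erase [] =
    l.subroots.image (List.cons false) ∪ (r.subroots.erase []).image (List.cons true) := by
  ext v
  simp only [Finset.mem_erase, mem_subroots_node, Finset.mem_union, Finset.mem_image]
  constructor
  · rintro ⟨h0, h | h | ⟨p, hp, hp0, h⟩⟩
    · exact absurd h h0
    · exact Or.inl h
    · exact Or.inr ⟨p, ⟨hp0, hp⟩, h⟩
  · rintro (⟨p, hp, rfl⟩ | ⟨p, ⟨hp0, hp⟩, rfl⟩)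
    · exact ⟨by simp, Or.inr (Or.inl ⟨p, hp, rfl⟩)⟩
    · exact ⟨by simp, Or.inr (Or.inr ⟨p, hp, hp0, rfl⟩)⟩

section Coeff

variable [DecidableEq A]

theorem card_filter_leaves (t : BTree A) (x : A) :
    (t.leaves.filter fun u => t.label u = some x).card = t.labels.count x := by
  induction t with
  | leaf a =>
    by_cases h : a = x <;> simp [leaves, labels, label, Finset.filter_singleton, h]
  | node l r hl hr =>
    rw [leaves, Finset.filter_union, Finset.card_union_of_disjoint, Finset.filter_image,
      Finset.filter_image, Finset.card_image_of_injective _ List.cons_injective,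
      Finset.card_image_of_injective _ List.cons_injective, labels, List.count_append, ← hl, ← hr]
    · rfl
    · rw [Finset.disjoint_left]
      simp only [Finset.mem_filter, Finset.mem_image]
      rintro _ ⟨⟨p, _, rfl⟩, _⟩ ⟨⟨q, _, h⟩, _⟩
      simp at h

theorem mult_nil (t : BTree A) : t.mult [] = t.labels.count t.rlabel := by
  rw [mult, ← card_filter_leaves, label_rmLeaf_nil]
  simp

theorem mult_cons_false (l r : BTree A) (v : List Bool) :
    (node l r).mult (false :: v) = l.mult v := by
  rw [mult, mult, leaves, Finset.filter_union, Finset.filter_image, Finset.filter_image,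
    Finset.card_union_of_disjoint, Finset.card_image_of_injective _ List.cons_injective]
  · simp [rmLeaf_cons_false, label]
  · rw [Finset.disjoint_left]
    simp only [Finset.mem_filter, Finset.mem_image]
    rintro _ ⟨p, _, rfl⟩ ⟨q, _, h⟩
    simp at h

theorem mult_cons_true (l r : BTree A) (v : List Bool) :
    (node l r).mult (true :: v) = r.mult v := by
  rw [mult, mult, leaves, Finset.filter_union, Finset.filter_image, Finset.filter_image,
    Finset.card_union_of_disjoint, Finset.card_image_of_injective _ List.cons_injective,
    Finset.card_image_of_injective _ List.cons_injective]
  · simp [rmLeaf_cons_true, label]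
  · rw [Finset.disjoint_left]
    simp only [Finset.mem_filter, Finset.mem_image]
    rintro _ ⟨p, _, rfl⟩ ⟨q, _, h⟩
    simp at h

theorem prod_subroots_erase (t : BTree A) :
    ∏ v ∈ t.subroots.erase [], bernCoeff (t.dist v) / (t.mult v : ℚ) = t.coeffTail := by
  induction t with
  | leaf a => simp [subroots_leaf, coeffTail]
  | node l r _ hr =>
    rw [subroots_node, Finset.prod_union, Finset.prod_image List.cons_injective.injOn,
      Finset.prod_image List.cons_injective.injOn, coeffTail, ← hr, coeff]
    · simp only [mult_cons_false, mult_cons_true, dist]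
    · rw [Finset.disjoint_left]
      simp only [Finset.mem_image]
      rintro _ ⟨p, _, rfl⟩ ⟨q, _, h⟩
      simp at h

/-- A single leaf fits the same formula because b_0 = 1 and its label occurs once, so later
arguments need not separate it. -/
theorem coeff_eq (t : BTree A) :
    t.coeff = bernCoeff (t.dist []) / (t.labels.count t.rlabel : ℚ) * t.coeffTail := by
  cases t with
  | leaf a => simp [coeff, subroots_leaf, dist, labels, rlabel, coeffTail, bernCoeff]
  | node l r =>
    rw [coeff, ← Finset.mul_prod_erase _ _ (mem_subroots_node.2 (Or.inl rfl)), prod_subroots_erase,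
      mult_nil]

end Coeff

end BTree

/-! ### The derivative of an exponential. -/

section DerivationExp

variable {K P : Type*} [Field K] [Ring P] [Algebra K P]

/-- The derivative of a power in terms of the iterated adjoint action:
`D (z ^ (n + 1)) = ∑ (n + 1).choose (i + 1) (ad z) ^ i (D z) z ^ (n - i)`. -/
theorem derivation_pow_succ (D : P →ₗ[K] P) (hD : ∀ x y, D (x * y) = D x * y + x * D y) (z : P)
    (n : ℕ) : D (z ^ (n + 1)) = ∑ p ∈ Finset.HasAntidiagonal.antidiagonal n,
      ((n + 1).choose (p.1 + 1) : K) • ((LieAlgebra.ad K P z ^ p.1) (D z) * z ^ p.2) := by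
  induction n with
  | zero => simp
  | succ n ih =>
    -- Moving z to the right, z w = [z, w] + w z, turns the induction into Pascal's rule.
    have hz : ∀ i j, z * ((LieAlgebra.ad K P z ^ i) (D z) * z ^ j) =
        (LieAlgebra.ad K P z ^ (i + 1)) (D z) * z ^ j +
          (LieAlgebra.ad K P z ^ i) (D z) * z ^ (j + 1) := by
      intro i j
      rw [pow_succ' (LieAlgebra.ad K P z), Module.End.mul_apply, LieAlgebra.ad_apply, Ring.lie_def,
        pow_succ']
      noncomm_ring
    rw [pow_succ', hD, ih, Finset.mul_sum]
    simp only [mul_smul_comm, hz, smul_add, Finset.sum_add_distrib]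
    have hc : ∀ p ∈ Finset.HasAntidiagonal.antidiagonal (n + 1),
        ((n + 1 + 1).choose (p.1 + 1) : K) • ((LieAlgebra.ad K P z ^ p.1) (D z) * z ^ p.2) =
        ((n + 1).choose p.1 : K) • ((LieAlgebra.ad K P z ^ p.1) (D z) * z ^ p.2) +
        ((n + 1).choose (p.1 + 1) : K) • ((LieAlgebra.ad K P z ^ p.1) (D z) * z ^ p.2) := by
      intro p _
      rw [Nat.choose_succ_succ, Nat.cast_add, add_smul]
    rw [Finset.sum_congr rfl hc, Finset.sum_add_distrib, Finset.Nat.sum_antidiagonal_succ,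
      Finset.Nat.sum_antidiagonal_succ' (n := n) (f := fun p => ((n + 1).choose (p.1 + 1) : K) •
        ((LieAlgebra.ad K P z ^ p.1) (D z) * z ^ p.2))]
    simp
    abel

variable {F : ℕ → Submodule K P} {N : ℕ}

theorem IsNilFiltration.ad_pow_mem (hF : IsNilFiltration F N) {z : P} (hz : z ∈ F 1) {m : ℕ} {w : P}
    (hw : w ∈ F m) (i : ℕ) : (LieAlgebra.ad K P z ^ i) w ∈ F (i + m) := by
  induction i with
  | zero => simpa using hw
  | succ i ih =>
    rw [pow_succ', Module.End.mul_apply, LieAlgebra.ad_apply]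
    have := hF.lie_mem hz ih
    rwa [show 1 + (i + m) = i + 1 + m by ring] at this

theorem IsNilFiltration.ad_pow_eq_zero (hF : IsNilFiltration F N) {z : P} (hz : z ∈ F 1) :
    LieAlgebra.ad K P z ^ (N + 1) = 0 := by
  ext w
  exact hF.eq_zero_of_mem N.lt_succ_self (by simpa using hF.ad_pow_mem hz (hF.mem_zero w) (N + 1))

variable [CharZero K]

theorem choose_mul_inv_factorial {i j n : ℕ} (h : i + j = n) :
    ((n + 1)! : K)⁻¹ * ((n + 1).choose (i + 1) : K) = ((i + 1)! : K)⁻¹ * (j ! : K)⁻¹ := by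
  subst h
  have h1 := Nat.choose_mul_factorial_mul_factorial (n := i + j + 1) (k := i + 1) (by omega)
  rw [show i + j + 1 - (i + 1) = j by omega] at h1
  have h2 : ((i + 1)! : K) ≠ 0 := Nat.cast_ne_zero.2 (Nat.factorial_ne_zero _)
  have h3 : (j ! : K) ≠ 0 := Nat.cast_ne_zero.2 (Nat.factorial_ne_zero _)
  have h4 : ((i + j + 1)! : K) ≠ 0 := Nat.cast_ne_zero.2 (Nat.factorial_ne_zero _)
  rw [← mul_inv, inv_mul_eq_iff_eq_mul₀ h4, eq_mul_inv_iff_mul_eq₀ (mul_ne_zero h2 h3), ← h1]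
  push_cast
  ring

/-- The derivative of the exponential: `D (e^z) = ((e^(ad z) - 1) / ad z) (D z) e^z`. -/
theorem IsNilFiltration.derivation_truncExp (hF : IsNilFiltration F N) (D : P →ₗ[K] P)
    (hD : ∀ x y, D (x * y) = D x * y + x * D y) {z : P} (hz : z ∈ F 1) (hDz : D z ∈ F 1) :
    D (truncExp K N z) = (∑ i ∈ Finset.range (N + 1),
      ((i + 1)! : K)⁻¹ • (LieAlgebra.ad K P z ^ i) (D z)) * truncExp K N z := by
  have h1 : D 1 = 0 := by
    have := hD 1 1
    simpa using this
  -- `D z` itself has weight 1, so terms vanish already at i + j = N. This removes the last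
  -- antidiagonal of the product, which the derivative of the truncated series lacks.
  have hc : ∀ i j, N ≤ i + j → (((i + 1)! : K)⁻¹ * (j ! : K)⁻¹) •
      ((LieAlgebra.ad K P z ^ i) (D z) * z ^ j) = 0 := by
    intro i j hij
    rw [hF.eq_zero_of_mem (n := i + 1 + 1 * j) (by omega)
      (hF.mul_mem (hF.ad_pow_mem hz hDz i) (hF.pow_mem hz j)), smul_zero]
  unfold truncExp
  rw [Finset.sum_mul_sum, map_sum, Finset.sum_range_succ']
  simp only [smul_mul_smul_comm]
  rw [← Finset.sum_range_sum_antidiagonal (N + 1) (fun p => (((p.1 + 1)! : K)⁻¹ * (p.2 ! : K)⁻¹) •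
    ((LieAlgebra.ad K P z ^ p.1) (D z) * z ^ p.2)) (fun i j h => hc i j (by omega)),
    Finset.sum_range_succ]
  congr 1
  · refine Finset.sum_congr rfl fun n _ => ?_
    rw [map_smul, derivation_pow_succ D hD, Finset.smul_sum]
    refine Finset.sum_congr rfl fun p hp => ?_
    rw [smul_smul, choose_mul_inv_factorial (Finset.HasAntidiagonal.mem_antidiagonal.1 hp)]
  · rw [Finset.sum_eq_zero fun p hp =>
      hc p.1 p.2 (Finset.HasAntidiagonal.mem_antidiagonal.1 hp).ge]
    simp [h1]

/-- The series (e^x - 1)/x and x/(e^x - 1) are inverse; this is where the Bernoulli numbers enter.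
-/
theorem mk_inv_factorial_mul_mk_bernCoeff :
    (PowerSeries.mk fun i => ((i + 1)! : K)⁻¹) *
      (PowerSeries.mk fun n => ((BTree.bernCoeff n : ℚ) : K)) = 1 := by
  have h := congrArg (PowerSeries.map (algebraMap ℚ K)) BTree.bernCoeff_generating
  rw [map_mul, map_sub, map_one, PowerSeries.map_exp, PowerSeries.map_X] at h
  have h1 : PowerSeries.map (algebraMap ℚ K) (PowerSeries.mk BTree.bernCoeff) =
      PowerSeries.mk fun n => ((BTree.bernCoeff n : ℚ) : K) := by
    ext n; simp
  have h2 : PowerSeries.exp K - 1 =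
      PowerSeries.X * PowerSeries.mk fun i => ((i + 1)! : K)⁻¹ := by
    ext n
    cases n with
    | zero => simp
    | succ n => rw [PowerSeries.coeff_succ_X_mul]; simp [PowerSeries.coeff_one]
  rw [h1, h2, mul_comm, mul_assoc] at h
  exact mul_left_cancel₀ PowerSeries.X_ne_zero (h.trans (mul_one _).symm)

/-- If `D z = (ad z / (e^(ad z) - 1)) (a)` then `D (e^z) = a e^z`. -/
theorem IsNilFiltration.derivation_truncExp_of_bernoulli (hF : IsNilFiltration F N) (D : P →ₗ[K] P)
    (hD : ∀ x y, D (x * y) = D x * y + x * D y) {z a : P} (hz : z ∈ F 1) (hDz : D z ∈ F 1)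
    (h : D z = ∑ n ∈ Finset.range (N + 1),
      ((BTree.bernCoeff n : ℚ) : K) • (LieAlgebra.ad K P z ^ n) a) :
    D (truncExp K N z) = a * truncExp K N z := by
  rw [hF.derivation_truncExp D hD hz hDz]
  congr 1
  have h0 := hF.ad_pow_eq_zero hz
  have h1 := congrArg (PowerSeries.nilEval (LieAlgebra.ad K P z) (N + 1) h0 N.succ_pos)
    (mk_inv_factorial_mul_mk_bernCoeff (K := K))
  rw [map_mul, map_one, PowerSeries.nilEval_apply, PowerSeries.nilEval_apply] at h1
  have h2 := LinearMap.congr_fun h1 a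
  simp only [PowerSeries.coeff_mk, Module.End.mul_apply, LinearMap.sum_apply,
    LinearMap.smul_apply, Module.End.one_apply] at h2
  rw [← h] at h2
  exact h2

end DerivationExp

/-! ### Polynomials in a central variable, and the equation f' = a f. -/

section PolynomialFiltration

open Polynomial

variable {K Q : Type*} [Field K] [Ring Q] [Algebra K Q]

/-- The polynomials with coefficients in the `n`-th step of a filtration. -/
def polyFiltration (F : ℕ → Submodule K Q) (n : ℕ) : Submodule K Q[X] where
  carrier := {p | ∀ i, p.coeff i ∈ F n}
  add_mem' hp hq i := by rw [coeff_add]; exact add_mem (hp i) (hq i)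
  zero_mem' i := by simp
  smul_mem' c p hp i := by rw [coeff_smul]; exact (F n).smul_mem c (hp i)

variable {F : ℕ → Submodule K Q} {N : ℕ}

theorem IsNilFiltration.polyFiltration (hF : IsNilFiltration F N) :
    IsNilFiltration (polyFiltration F) N where
  zero_eq_top := eq_top_iff.2 fun p _ i => hF.mem_zero _
  anti _ _ h _ hp i := hF.anti h (hp i)
  mul_mem hp hq i := by
    rw [coeff_mul]
    exact sum_mem fun x _ => hF.mul_mem (hp _) (hq _)
  eq_bot := by
    rw [eq_bot_iff]
    intro p hp
    rw [Submodule.mem_bot]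
    ext i
    exact hF.eq_zero_of_mem N.lt_succ_self (hp i)

theorem monomial_mem_polyFiltration {n i : ℕ} {x : Q} (hx : x ∈ F n) :
    monomial i x ∈ polyFiltration F n := by
  intro j
  rw [coeff_monomial]
  split_ifs
  · exact hx
  · exact zero_mem _

theorem derivative_mem_polyFiltration {n : ℕ} {p : Q[X]} (hp : p ∈ polyFiltration F n) :
    derivative p ∈ polyFiltration F n := by
  intro i
  rw [coeff_derivative, ← Nat.cast_succ, ← Nat.cast_comm, ← nsmul_eq_mul]
  exact nsmul_mem (hp _) _

theorem lie_monomial (i j : ℕ) (x y : Q) :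
    ⁅monomial i x, monomial j y⁆ = monomial (i + j) ⁅x, y⁆ := by
  rw [Ring.lie_def, monomial_mul_monomial, monomial_mul_monomial, add_comm j i, ← map_sub,
    Ring.lie_def]

variable (K Q) in
/-- Evaluation at `1` of polynomials over a noncommutative algebra. -/
noncomputable def evalOne : Q[X] →ₐ[K] Q :=
  eval₂AlgHom (AlgHom.id K Q) 1 fun _ => Commute.one_right _

variable (K Q) in
/-- The constant coefficient of polynomials over a noncommutative algebra. -/
noncomputable def evalZero : Q[X] →ₐ[K] Q :=
  eval₂AlgHom (AlgHom.id K Q) 0 fun _ => Commute.zero_right _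

theorem evalZero_apply (p : Q[X]) : evalZero K Q p = p.coeff 0 :=
  (coeff_zero_eq_eval_zero p).symm

theorem evalOne_apply (p : Q[X]) : evalOne K Q p = p.eval 1 := rfl

variable [CharZero K]

theorem IsNilFiltration.evalOne_of_derivative_eq (hF : IsNilFiltration F N) {f : Q[X]} {a : Q}
    (ha : a ∈ F 1) (h : derivative f = C a * f) :
    evalOne K Q f = truncExp K N a * f.coeff 0 := by
  have hc : ∀ m, f.coeff m = (m ! : K)⁻¹ • a ^ m * f.coeff 0 := by
    intro m
    induction m with
    | zero => simp
    | succ m ih =>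
      have h1 := congrArg (fun p => p.coeff m) h
      simp only [coeff_derivative, coeff_C_mul] at h1
      have h2 : f.coeff (m + 1) * ((m : Q) + 1) = ((m + 1 : ℕ) : K) • f.coeff (m + 1) := by
        rw [← Nat.cast_succ, (Nat.cast_commute (m + 1) _).eq.symm, ← nsmul_eq_mul,
          Nat.cast_smul_eq_nsmul]
      have hm : ((m + 1 : ℕ) : K) ≠ 0 := Nat.cast_ne_zero.2 (Nat.succ_ne_zero m)
      rw [h2, ih] at h1
      rw [← inv_smul_smul₀ hm (f.coeff (m + 1)), h1, Nat.factorial_succ, Nat.cast_mul, mul_inv,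
        pow_succ']
      simp only [smul_mul_assoc, mul_smul_comm, smul_smul, mul_assoc]
  -- The degree of f need not be N, so both sums are compared inside a common range; beyond N the
  -- power of a is zero.
  rw [evalOne_apply, eval_eq_sum_range' (n := max (f.natDegree + 1) (N + 1)) (by omega), truncExp,
    Finset.sum_mul]
  symm
  refine Finset.sum_subset_zero_on_sdiff (Finset.range_mono (le_max_right _ _)) ?_ ?_
  · intro m hm
    simp only [Finset.mem_sdiff, Finset.mem_range, not_lt] at hm
    have h0 : a ^ m = 0 := hF.eq_zero_of_mem hm.2 (by simpa using hF.pow_mem ha m)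
    rw [one_pow, mul_one, hc, h0, smul_zero, zero_mul]
  · intro m _
    rw [one_pow, mul_one, ← hc]

end PolynomialFiltration

/-! ### The differential equation of the tree series. -/

namespace BTree

section Trees

variable {A : Type*} [Finite A] [LE A]

open Classical in
/-- The posetted trees with at most `N` leaves and with labels that satisfy `p`. -/
noncomputable def posettedLE (p : A → Prop) (N : ℕ) : Finset (BTree A) :=
  (finite_numLeaves_le (A := A) N).toFinset.filter fun t => t.IsPosetted ∧ ∀ x ∈ t.labels, p x

theorem mem_posettedLE {p : A → Prop} {N : ℕ} {t : BTree A} :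
    t ∈ posettedLE p N ↔ t.numLeaves ≤ N ∧ t.IsPosetted ∧ ∀ x ∈ t.labels, p x := by
  simp [posettedLE]

variable (K : Type*) {L : Type*} [Field K] [LieRing L] [LieAlgebra K L] [DecidableEq A]

/-- The sum of `b_Γ Z_Γ` over the posetted trees with at most `N` leaves and with labels that
satisfy `p`. -/
noncomputable def treeSum (p : A → Prop) (N : ℕ) (a : A → L) : L :=
  ∑ t ∈ posettedLE p N, ((t.coeff : ℚ) : K) • t.bracket a

end Trees

theorem map_bracket {A K L L' : Type*} [Field K] [LieRing L] [LieAlgebra K L] [LieRing L']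
    [LieAlgebra K L'] (f : L →ₗ⁅K⁆ L') (a : A → L) (t : BTree A) :
    f (t.bracket a) = t.bracket (fun i => f (a i)) := by
  induction t with
  | leaf i => rfl
  | node l r hl hr => rw [bracket, bracket, LieHom.map_lie, hl, hr]

theorem map_treeSum {A K L L' : Type*} [Finite A] [LE A] [DecidableEq A] [Field K] [LieRing L]
    [LieAlgebra K L] [LieRing L'] [LieAlgebra K L'] (f : L →ₗ⁅K⁆ L') (p : A → Prop) (N : ℕ)
    (a : A → L) : f (treeSum K p N a) = treeSum K p N (fun i => f (a i)) := by
  simp [treeSum, map_bracket]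

theorem bracket_mem {A K Q : Type*} [Field K] [Ring Q] [Algebra K Q] {F : ℕ → Submodule K Q} {N : ℕ}
    (hF: IsNilFiltration F N) {a : A → Q} (ha : ∀ i, a i ∈ F 1) (t : BTree A) :
    t.bracket a ∈ F t.numLeaves := by
  induction t with
  | leaf i => rw [numLeaves_leaf]; exact ha i
  | node l r hl hr => rw [numLeaves_node]; exact hF.lie_mem hl hr

section ODE

open Polynomial

variable {A K Q : Type*} [Fintype A] [LinearOrder A] [Field K] [Ring Q] [Algebra K Q]
  {F : ℕ → Submodule K Q} {N : ℕ}

variable (K)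

/-- The generating polynomial of the posetted trees with labels `≤ e`, where the exponent counts
the leaves with label `e`. -/
noncomputable def treePoly (e : A) (N : ℕ) (a : A → Q) : Q[X] :=
  ∑ t ∈ posettedLE (· ≤ e) N,
    monomial (t.labels.count e) (((t.coeff : ℚ) : K) • t.bracket a)

/-- The part of the derivative of `treePoly` that comes from trees with a rightmost branch of
length `n`. -/
noncomputable def branchPoly (e : A) (N : ℕ) (a : A → Q) (n : ℕ) : Q[X] :=
  ∑ t ∈ (posettedLE (· ≤ e) N).filter (fun t => t.rlabel = e ∧ t.dist [] = n),
    monomial (t.labels.count e - 1) (((t.coeffTail : ℚ) : K) • t.bracket a)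

variable {K}

theorem treePoly_mem (hF : IsNilFiltration F N) {a : A → Q} (ha : ∀ i, a i ∈ F 1) (e : A) :
    treePoly K e N a ∈ polyFiltration F 1 :=
  sum_mem fun t _ => monomial_mem_polyFiltration 
    ((F 1).smul_mem _ (hF.anti t.numLeaves_pos (bracket_mem hF ha t)))

theorem branchPoly_zero (hF : IsNilFiltration F N) {a : A → Q} (ha : ∀ i, a i ∈ F 1) (e : A) :
    branchPoly K e N a 0 = C (a e) := by
  rw [branchPoly, Finset.sum_subset (s₂ := {leaf e})]
  · simp [coeffTail, labels, bracket]
  · rintro t ht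
    simp only [Finset.mem_filter] at ht
    cases t with
    | leaf i => simpa [rlabel] using ht.2.1
    | node l r => simp [dist] at ht
  · rintro t ht h
    rw [Finset.mem_singleton] at ht
    subst ht
    -- The leaf is missing only for N = 0, and then `a e` is zero.
    have h0 : N < (leaf e).numLeaves := by
      by_contra hN
      exact h (Finset.mem_filter.2 ⟨mem_posettedLE.2 ⟨not_lt.1 hN, isPosetted_leaf e,
        by simp [labels]⟩, rfl, rfl⟩)
    rw [hF.eq_zero_of_mem h0 (bracket_mem hF ha _), smul_zero, map_zero]

variable [CharZero K]

/-- Cutting at the root: `l` ranges over all posetted trees with labels ≤ e, since the condition at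
the root is exactly that bound, and `r` has a rightmost branch one step shorter. Pairs with more
than N leaves in all contribute zero. -/
theorem branchPoly_succ (hF : IsNilFiltration F N) {a : A → Q} (ha : ∀ i, a i ∈ F 1) (e : A)
    (n : ℕ) : branchPoly K e N a (n + 1) = ⁅treePoly K e N a, branchPoly K e N a n⁆ := by
  have key : ∀ l r : BTree A, r.rlabel = e →
      ⁅monomial (l.labels.count e) (((l.coeff : ℚ) : K) • l.bracket a),
        monomial (r.labels.count e - 1) (((r.coeffTail : ℚ) : K) • r.bracket a)⁆ =
      monomial ((node l r).labels.count e - 1)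
        ((((node l r).coeffTail : ℚ) : K) • (node l r).bracket a) := by
    rintro l r rfl
    have h := List.count_pos_iff.2 r.rlabel_mem_labels
    rw [lie_monomial, labels, List.count_append, coeffTail, bracket, Rat.cast_mul,
      Nat.add_sub_assoc h, Ring.lie_def, Ring.lie_def, smul_mul_smul_comm, smul_mul_smul_comm,
      mul_comm (r.coeffTail : K), smul_sub]
  have hz : ∀ t : BTree A, N < t.numLeaves → ∀ i (c : K), monomial i (c • t.bracket a) = 0 := by
    intro t ht i c
    rw [hF.eq_zero_of_mem ht (bracket_mem hF ha t), smul_zero, map_zero]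
  rw [treePoly, branchPoly, branchPoly, sum_lie_sum, ← Finset.sum_product']
  symm
  have hz' : ∀ x ∈ posettedLE (· ≤ e) N ×ˢ
      (posettedLE (· ≤ e) N).filter (fun t => t.rlabel = e ∧ t.dist [] = n),
      ¬ (x.1.numLeaves + x.2.numLeaves ≤ N) →
      ⁅monomial (x.1.labels.count e) (((x.1.coeff : ℚ) : K) • x.1.bracket a),
        monomial (x.2.labels.count e - 1) (((x.2.coeffTail : ℚ) : K) • x.2.bracket a)⁆ = 0 := by
    rintro ⟨l, r⟩ hx hN
    rw [Finset.mem_product, Finset.mem_filter] at hx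
    rw [key l r hx.2.2.1]
    exact hz _ (by rw [numLeaves_node]; exact not_le.1 hN) _ _
  rw [← Finset.sum_filter_of_ne (p := fun x => x.1.numLeaves + x.2.numLeaves ≤ N)
    (fun x hx hne => by by_contra hN; exact hne (hz' x hx hN))]
  refine Finset.sum_bij (fun x _ => node x.1 x.2) ?_ ?_ ?_ ?_
  · rintro ⟨l, r⟩ hx
    simp only [Finset.mem_filter, Finset.mem_product, mem_posettedLE] at hx ⊢
    obtain ⟨⟨⟨-, hl, hle⟩, ⟨-, hr, hre⟩, hrl, hd⟩, hN⟩ := hx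
    refine ⟨⟨by rw [numLeaves_node]; exact hN, isPosetted_node.2 ⟨hl, hr, ?_⟩, ?_⟩, hrl, by
      rw [dist, hd]⟩
    · rw [hrl]; exact hle
    · intro x hx
      exact (List.mem_append.1 hx).elim (hle x) (hre x)
  · rintro ⟨l, r⟩ _ ⟨l', r'⟩ _ h
    simp only [node.injEq] at h
    rw [h.1, h.2]
  · intro t ht
    simp only [Finset.mem_filter, mem_posettedLE] at ht
    obtain ⟨⟨hN, hp, hle⟩, hrl, hd⟩ := ht
    cases t with
    | leaf i => simp [dist] at hd
    | node l r =>
      rw [isPosetted_node] at hp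
      rw [numLeaves_node] at hN
      refine ⟨(l, r), ?_, rfl⟩
      simp only [Finset.mem_filter, Finset.mem_product, mem_posettedLE]
      exact ⟨⟨⟨by omega, hp.1, fun x hx => hle x (List.mem_append_left _ hx)⟩,
        ⟨by omega, hp.2.1, fun x hx => hle x (List.mem_append_right _ hx)⟩, hrl,
        by simpa [dist] using hd⟩, hN⟩
  · rintro ⟨l, r⟩ hx
    simp only [Finset.mem_filter, Finset.mem_product] at hx
    exact key l r hx.1.2.2.1

theorem branchPoly_eq (hF : IsNilFiltration F N) {a : A → Q} (ha : ∀ i, a i ∈ F 1) (e : A)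
    (n : ℕ) : branchPoly K e N a n = (LieAlgebra.ad K Q[X] (treePoly K e N a) ^ n) (C (a e)) := by
  induction n with
  | zero => rw [branchPoly_zero hF ha]; simp
  | succ n ih => rw [branchPoly_succ hF ha, ih, pow_succ']; simp

theorem derivative_treePoly (hF : IsNilFiltration F N) {a : A → Q} (ha : ∀ i, a i ∈ F 1) (e : A) :
    derivative (treePoly K e N a) = ∑ n ∈ Finset.range (N + 1),
      ((bernCoeff n : ℚ) : K) • (LieAlgebra.ad K Q[X] (treePoly K e N a) ^ n) (C (a e)) := by
  simp only [← branchPoly_eq hF ha]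
  -- The rightmost label is maximal, so trees not ending in `e` do not contain `e` and are
  -- constants. For the others the exponent produced by the derivative cancels t(root).
  have h1 : ∀ t ∈ posettedLE (· ≤ e) N,
      derivative (monomial (t.labels.count e) (((t.coeff : ℚ) : K) • t.bracket a)) =
      if t.rlabel = e then ((bernCoeff (t.dist []) : ℚ) : K) •
        monomial (t.labels.count e - 1) (((t.coeffTail : ℚ) : K) • t.bracket a) else 0 := by
    intro t ht
    obtain ⟨-, hp, hle⟩ := mem_posettedLE.1 ht
    rw [derivative_monomial]
    split_ifs with h
    · subst h
      have h0 : ((t.labels.count t.rlabel : ℕ) : K) ≠ 0 :=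
        Nat.cast_ne_zero.2 (List.count_pos_iff.2 t.rlabel_mem_labels).ne'
      rw [smul_monomial, ← (Nat.cast_commute _ _).eq, ← nsmul_eq_mul, ← Nat.cast_smul_eq_nsmul K,
        smul_smul, smul_smul, coeff_eq]
      congr 2
      push_cast
      field_simp
    · have hlt : t.rlabel < e := lt_of_le_of_ne (hle _ t.rlabel_mem_labels) h
      have h0 : t.labels.count e = 0 :=
        List.count_eq_zero.2 fun he => (hp.le_rlabel he).not_gt hlt
      simp [h0]
  rw [treePoly, map_sum, Finset.sum_congr rfl h1, ← Finset.sum_filter,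
    ← Finset.sum_fiberwise_of_maps_to (t := Finset.range (N + 1)) (g := fun t => t.dist [])]
  · refine Finset.sum_congr rfl fun n _ => ?_
    rw [branchPoly, Finset.smul_sum, Finset.filter_filter]
    refine Finset.sum_congr rfl fun t ht => ?_
    rw [(Finset.mem_filter.1 ht).2.2]
  · intro t ht
    have h2 := (mem_posettedLE.1 (Finset.mem_filter.1 ht).1).1
    have := t.dist_nil_lt_numLeaves
    rw [Finset.mem_range]
    omega

/-- Adding a greatest label multiplies the exponential of the sum over posetted trees. -/
theorem truncExp_treeSum_le (hF : IsNilFiltration F N) {a : A → Q} (ha : ∀ i, a i ∈ F 1) (e : A) :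
    truncExp K N (treeSum K (· ≤ e) N a) =
      truncExp K N (a e) * truncExp K N (treeSum K (· < e) N a) := by
  have hZ := treePoly_mem hF ha e
  have h := hF.polyFiltration.derivation_truncExp_of_bernoulli
    (derivative.restrictScalars K) (fun x y => derivative_mul) hZ
    (derivative_mem_polyFiltration hZ) (derivative_treePoly hF ha e)
  have h1 := hF.evalOne_of_derivative_eq (ha e) h
  rw [← evalZero_apply (K := K), AlgHom.map_truncExp, AlgHom.map_truncExp] at h1
  have h2 : evalOne K Q (treePoly K e N a) = treeSum K (· ≤ e) N a := by
    simp [treePoly, treeSum, evalOne_apply, eval_monomial]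
  -- At 0 exactly the trees without a leaf labelled `e` survive.
  have h3 : evalZero K Q (treePoly K e N a) = treeSum K (· < e) N a := by
    rw [evalZero_apply, treePoly, finsetSum_coeff, treeSum]
    simp only [coeff_monomial]
    rw [← Finset.sum_filter]
    refine Finset.sum_congr ?_ fun _ _ => rfl
    ext t
    simp only [Finset.mem_filter, mem_posettedLE, List.count_eq_zero]
    constructor
    · rintro ⟨⟨h1, h2, h3⟩, h4⟩
      exact ⟨h1, h2, fun x hx => lt_of_le_of_ne (h3 x hx) fun he => h4 (he ▸ hx)⟩
    · rintro ⟨h1, h2, h3⟩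
      exact ⟨⟨h1, h2, fun x hx => (h3 x hx).le⟩, fun he => lt_irrefl _ (h3 _ he)⟩
  rw [h2, h3] at h1
  exact h1

/-- The exponential of the sum over posetted trees is the product of the exponentials of the
labels, in decreasing order. -/
theorem truncExp_treeSum (hF : IsNilFiltration F N) {k : ℕ} {a : Fin k → Q}
    (ha : ∀ i, a i ∈ F 1) : truncExp K N (treeSum K (fun _ => True) N a) =
      ((List.ofFn a).reverse.map (truncExp K N)).prod := by
  have h : ∀ j ≤ k, truncExp K N (treeSum K (fun i : Fin k => i.val < j) N a) =
      (((List.ofFn a).take j).reverse.map (truncExp K N)).prod := by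
    intro j hj
    induction j with
    | zero =>
      have : posettedLE (fun i : Fin k => i.val < 0) N = ∅ := by
        rw [Finset.eq_empty_iff_forall_notMem]
        intro t ht
        exact absurd ((mem_posettedLE.1 ht).2.2 _ t.rlabel_mem_labels) (Nat.not_lt_zero _)
      rw [treeSum, this]
      simp [truncExp_zero]
    | succ j ih =>
      have h1 := truncExp_treeSum_le hF ha ⟨j, hj⟩
      have h2 : (fun i : Fin k => i ≤ ⟨j, hj⟩) = fun i : Fin k => i.val < j + 1 := by
        ext i; rw [Fin.le_def]; simp only; omega
      have h3 : (fun i : Fin k => i < ⟨j, hj⟩) = fun i : Fin k => i.val < j := by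
        ext i; rw [Fin.lt_def]
      rw [h2, h3, ih (by omega)] at h1
      rw [h1, List.take_succ_eq_append_getElem (by simpa using hj)]
      simp
  have h1 := h k le_rfl
  rw [List.take_of_length_le (by simp)] at h1
  rw [← h1]
  congr 2
  ext i
  simp

end ODE

end BTree

/-! ### Homogeneous components of log(e^x e^y) as tree sums. -/

section PowerSeriesFiltration

open PowerSeries

variable {R : Type*} [Ring R]

theorem PowerSeries.coeff_eq_zero_of_mem_ker_pow {n : ℕ} {f : PowerSeries R}
    (hf : f ∈ RingHom.ker (constantCoeff (R := R)) ^ n) {j : ℕ} (hj : j < n) : coeff j f = 0 := by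
  induction n generalizing f j with
  | zero => omega
  | succ n ih =>
    rw [Ideal.IsTwoSided.pow_succ] at hf
    induction hf using Submodule.mul_induction_on' with
    | mem_mul_mem a ha b hb =>
      rw [coeff_mul]
      refine Finset.sum_eq_zero fun p hp => ?_
      rw [Finset.HasAntidiagonal.mem_antidiagonal] at hp
      rcases Nat.eq_zero_or_pos p.1 with h0 | h0
      · rw [h0, coeff_zero_eq_constantCoeff, RingHom.mem_ker.1 ha, zero_mul]
      · rw [ih hb (by omega), mul_zero]
    | add a _ b _ ha hb => rw [map_add, ha, hb, add_zero]

theorem PowerSeries.X_mem_ker : (X : PowerSeries R) ∈ RingHom.ker (constantCoeff (R := R)) := by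
  simp [RingHom.mem_ker]

theorem PowerSeries.mem_ker_pow_of_coeff_eq_zero {n : ℕ} {f : PowerSeries R}
    (hf : ∀ j < n, coeff j f = 0) : f ∈ RingHom.ker (constantCoeff (R := R)) ^ n := by
  obtain ⟨g, rfl⟩ := X_pow_dvd_iff.2 hf
  have h : ∀ m, (X : PowerSeries R) ^ m ∈ RingHom.ker (constantCoeff (R := R)) ^ m := by
    intro m
    induction m with
    | zero => simp [Ideal.one_eq_top, Submodule.pow_zero]
    | succ m ih =>
      rw [Ideal.IsTwoSided.pow_succ, pow_succ']
      exact Ideal.mul_mem_mul X_mem_ker ih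
  exact Ideal.mul_mem_right _ _ (h n)

theorem PowerSeries.monomial_pow_one (x : R) (n : ℕ) :
    (monomial 1 x) ^ n = monomial n (x ^ n) := by
  induction n with
  | zero => simp
  | succ n ih => rw [pow_succ, ih, monomial_mul_monomial, pow_succ]

variable {K : Type*} [Field K] [Algebra K R]

theorem truncExp_monomial_sub_mem (x : R) (n : ℕ) :
    truncExp K n (monomial 1 x) - expSeries K x ∈
      RingHom.ker (constantCoeff (R := R)) ^ (n + 1) := by
  refine mem_ker_pow_of_coeff_eq_zero fun j hj => ?_
  rw [map_sub, truncExp, map_sum, expSeries, coeff_mk, Finset.sum_eq_single j]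
  · rw [monomial_pow_one, coeff_smul, coeff_monomial, if_pos rfl, sub_self]
  · intro i _ hij
    rw [monomial_pow_one, coeff_smul, coeff_monomial, if_neg hij.symm, smul_zero]
  · intro h
    exact absurd (Finset.mem_range.2 hj) h

end PowerSeriesFiltration

namespace BTree

section

variable {K R : Type*} [Field K] [Ring R] [Algebra K R]

theorem bracket_monomial {A : Type*} (a : A → R) (t : BTree A) :
    t.bracket (fun i => PowerSeries.monomial 1 (a i)) =
      PowerSeries.monomial t.numLeaves (t.bracket a) := by
  induction t with
  | leaf i => simp [bracket, numLeaves_leaf]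
  | node l r hl hr =>
    rw [bracket, bracket, hl, hr, numLeaves_node, Ring.lie_def, Ring.lie_def,
      PowerSeries.monomial_mul_monomial, PowerSeries.monomial_mul_monomial,
      add_comm r.numLeaves, map_sub]

theorem mem_posettedTrees {A : Type*} [Finite A] [LE A] {n : ℕ} {t : BTree A} :
    t ∈ posettedTrees A n ↔ t.IsPosetted ∧ t.numLeaves = n := by
  simp [posettedTrees]

theorem treeSum_mem {A : Type*} [Fintype A] [LinearOrder A] {F : ℕ → Submodule K R} {N : ℕ}
    (hF : IsNilFiltration F N) {a : A → R} (ha : ∀ i, a i ∈ F 1) (p : A → Prop) :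
    treeSum K p N a ∈ F 1 :=
  sum_mem fun t _ => (F 1).smul_mem _ (hF.anti t.numLeaves_pos (bracket_mem hF ha t))

variable [CharZero K]

theorem truncLog_prod_truncExp {F : ℕ → Submodule K R} {N : ℕ} (hF : IsNilFiltration F N) {k : ℕ}
    {a : Fin k → R} (ha : ∀ i, a i ∈ F 1) :
    truncLog K N (((List.ofFn a).reverse.map (truncExp K N)).prod) =
      treeSum K (fun _ => True) N a := by
  rw [← truncExp_treeSum hF ha, truncLog_truncExp (hF.pow_eq_zero (treeSum_mem hF ha _))]

/-- The homogeneous components of `log (e^x e^y)` are sums over posetted trees. -/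
theorem logCoeff_expSeries_mul (x y : R) (n : ℕ) :
    logCoeff K (expSeries K x * expSeries K y) n =
      ∑ t ∈ posettedTrees (Fin 2) n, ((t.coeff : ℚ) : K) • t.bracket ![y, x] := by
  let I : Ideal (PowerSeries R) := RingHom.ker (PowerSeries.constantCoeff (R := R))
  let q := Ideal.Quotient.mkₐ K (I ^ (n + 1))
  -- Replacing x, y by xT, yT modulo T^{n+1} makes them nilpotent, and a tree acquires T to the
  -- number of its leaves. The greater label is `x`, the left factor.
  let a : Fin 2 → PowerSeries R := fun i => PowerSeries.monomial 1 (![y, x] i)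
  have hF := isNilFiltration_quotFiltration K I n
  have hq : ∀ {f g : PowerSeries R}, f - g ∈ I ^ (n + 1) → q f = q g := fun h =>
    Ideal.Quotient.eq.2 h
  have ha : ∀ i, q (a i) ∈ quotFiltration K I n 1 := fun i =>
    mk_mem_quotFiltration K I n (by 
      rw [Submodule.pow_one, RingHom.mem_ker, ← PowerSeries.coeff_zero_eq_constantCoeff_apply,
        PowerSeries.coeff_monomial, if_neg zero_ne_one])
  have h1 := truncLog_prod_truncExp hF ha
  have h2 : ((List.ofFn fun i => q (a i)).reverse.map (truncExp K n)).prod =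
      q (expSeries K x * expSeries K y) := by
    have hx := hq (truncExp_monomial_sub_mem (K := K) x n)
    have hy := hq (truncExp_monomial_sub_mem (K := K) y n)
    rw [AlgHom.map_truncExp] at hx hy
    rw [map_mul, ← hx, ← hy]
    simp [List.ofFn_succ, a]
  have h3 : treeSum K (fun _ => True) n (fun i => q (a i)) =
      q (treeSum K (fun _ => True) n a) := (map_treeSum q.toLieHom _ _ _).symm
  rw [h2, h3, ← AlgHom.map_truncLog] at h1
  have h4 := PowerSeries.coeff_eq_zero_of_mem_ker_pow (Ideal.Quotient.eq.1 h1) n.lt_succ_self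
  rw [map_sub, sub_eq_zero] at h4
  have h5 : logCoeff K (expSeries K x * expSeries K y) n =
      PowerSeries.coeff n (truncLog K n (expSeries K x * expSeries K y)) := by
    simp [logCoeff, truncLog]
  rw [h5, h4, treeSum, map_sum]
  simp only [PowerSeries.coeff_smul, a, bracket_monomial, PowerSeries.coeff_monomial, smul_ite,
    smul_zero]
  rw [← Finset.sum_filter]
  refine Finset.sum_congr ?_ fun _ _ => rfl
  ext t
  simp only [Finset.mem_filter, mem_posettedLE, mem_posettedTrees]
  constructor
  · rintro ⟨⟨-, h, -⟩, h'⟩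
    exact ⟨h, h'.symm⟩
  · rintro ⟨h, h'⟩
    exact ⟨⟨h'.le, h, fun _ _ => trivial⟩, h'.symm⟩

end

end BTree

/-! ### Existence and degree of the BCH Lie polynomials. -/

section BCHLie

open FreeLieAlgebra

variable {K : Type*} [Field K]

theorem BTree.bracket_mem_lcs {A L : Type*} [LieRing L] [LieAlgebra K L] (a : A → L) (t : BTree A)
    {n : ℕ} (hn : n < t.numLeaves) :
    t.bracket a ∈ LieModule.lowerCentralSeries K L L n := by
  induction t generalizing n with
  | leaf i =>
    rw [numLeaves_leaf, Nat.lt_one_iff] at hn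
    simp [hn]
  | node l r hl hr =>
    rw [numLeaves_node] at hn
    have h1 := l.numLeaves_pos
    have h2 := r.numLeaves_pos
    have := lie_mem_lcs_add (hl (n := l.numLeaves - 1) (by omega))
      (hr (n := r.numLeaves - 1) (by omega))
    exact lcs_antitone (by omega) this

theorem toFree_mem_augIdeal_pow {X : Type*} {n : ℕ} {p : FreeLieAlgebra K X}
    (hp : p ∈ LieModule.lowerCentralSeries K (FreeLieAlgebra K X) (FreeLieAlgebra K X) n) :
    toFree K X p ∈ augIdeal K X ^ (n + 1) := by
  induction n generalizing p with
  | zero => simpa [Submodule.pow_one] using toFree_mem_augIdeal K X p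
  | succ n ih =>
    refine lcs_succ_induction (P := fun p => toFree K X p ∈ augIdeal K X ^ (n + 1 + 1))
      ?_ ?_ ?_ hp
    · simp
    · intro a b ha hb
      rw [map_add]; exact add_mem ha hb
    · intro a b hb
      have ha := toFree_mem_augIdeal K X a
      rw [LieHom.map_lie, Ring.lie_def]
      refine sub_mem ?_ ?_
      · rw [Ideal.IsTwoSided.pow_succ]
        exact Ideal.mul_mem_mul ha (ih hb)
      · rw [Ideal.IsTwoSided.pow_add, Submodule.pow_one]
        exact Ideal.mul_mem_mul (ih hb) ha

variable [CharZero K]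

theorem toFree_sum_posettedTrees (n : ℕ) : toFree K (Fin 2) (∑ t ∈ posettedTrees (Fin 2) n,
    ((t.coeff : ℚ) : K) • t.bracket ![of K 1, of K 0]) = bchPoly K n := by
  rw [bchPoly, BTree.logCoeff_expSeries_mul, map_sum]
  refine Finset.sum_congr rfl fun t _ => ?_
  rw [map_smul, BTree.map_bracket]
  congr 2
  ext i
  fin_cases i <;> simp

/-- The tree sum is an explicit Lie preimage, so the choice in `bchLie` is meaningful. -/
theorem toFree_bchLie (n : ℕ) : toFree K (Fin 2) (bchLie K n) = bchPoly K n :=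
  Classical.epsilon_spec (p := fun w => lieToFree K w = bchPoly K n)
    ⟨_, toFree_sum_posettedTrees n⟩

/-- The chosen preimage need not be compared with the tree sum inside the free Lie algebra: equality
of the associative images and the Dynkin argument suffice. -/
theorem bchLie_mem_lcs {n m : ℕ} (h : m < n) : bchLie K n ∈
    LieModule.lowerCentralSeries K (FreeLieAlgebra K (Fin 2)) (FreeLieAlgebra K (Fin 2)) m := by
  refine mem_lcs_of_toFree_mem m ?_
  rw [toFree_bchLie, ← toFree_sum_posettedTrees]
  refine toFree_mem_augIdeal_pow (sum_mem fun t ht => ?_)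
  exact (LieModule.lowerCentralSeries _ _ _ m).smul_mem _
    (BTree.bracket_mem_lcs _ _ (by rw [(BTree.mem_posettedTrees.1 ht).2]; exact h))

end BCHLie

/-! ### Convergence in the lower central series topology. -/

section Convergence

variable {K L : Type*} [Field K] [LieRing L] [LieAlgebra K L]

local notation "γ" => LieModule.lowerCentralSeries K L L

theorem LCSHasSum.of_finset {ι : Type*} {s : ι → L} {c : L} (S : ℕ → Finset ι)
    (hS : ∀ m, ∑ i ∈ S m, s i - c ∈ γ m) (h : ∀ m, ∀ i ∉ S m, s i ∈ γ m) : LCSHasSum K s c := by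
  classical
  intro m
  refine ⟨S m, fun F hF => ?_⟩
  rw [← Finset.sum_sdiff hF, add_sub_assoc]
  exact add_mem (sum_mem fun i hi => h m i (Finset.mem_sdiff.1 hi).2) (hS m)

theorem IsLCSComplete.eq_of_sub_mem (hL : IsLCSComplete K L) {c c' : L}
    (h : ∀ m, c - c' ∈ γ m) : c = c' :=
  sub_eq_zero.1 (hL.separated _ h)

theorem LCSHasSum.unique (hL : IsLCSComplete K L) {ι : Type*} {s : ι → L} {c c' : L}
    (h : LCSHasSum K s c) (h' : LCSHasSum K s c') : c = c' := by
  classical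
  refine hL.eq_of_sub_mem fun m => ?_
  obtain ⟨F, hF⟩ := h m
  obtain ⟨F', hF'⟩ := h' m
  have := sub_mem (hF' (F ∪ F') Finset.subset_union_right)
    (hF (F ∪ F') Finset.subset_union_left)
  rwa [sub_sub_sub_cancel_left] at this

theorem IsLCSComplete.exists_limit (hL : IsLCSComplete K L) (s : ℕ → L)
    (hs : ∀ m p, m ≤ p → s p - s m ∈ γ m) : ∃ c, ∀ m, s m - c ∈ γ m := by
  obtain ⟨c, hc⟩ := hL.complete s fun m => ⟨m, fun p q hp hq => by
    have := sub_mem (hs m p hp) (hs m q hq)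
    rwa [sub_sub_sub_cancel_right] at this⟩
  refine ⟨c, fun m => ?_⟩
  obtain ⟨N, hN⟩ := hc m
  have := sub_mem (hN _ (le_max_left N m)) (hs m _ (le_max_right N m))
  rwa [sub_sub_sub_cancel_left] at this

end Convergence

/-! ### Elements of `L` represented by logarithms of products. -/

section TruncatedFreeAlgebra

open FreeLieAlgebra

variable {K X : Type*} [Field K]

variable (K X) in
/-- The projection of the free associative algebra to its quotient by the words with more
than `N` letters. -/
noncomputable def truncQuot (N : ℕ) :
    FreeAlgebra K X →ₐ[K] FreeAlgebra K X ⧸ augIdeal K X ^ (N + 1) :=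
  Ideal.Quotient.mkₐ K _

theorem truncQuot_toFree_mem (N : ℕ) (p : FreeLieAlgebra K X) :
    truncQuot K X N (toFree K X p) ∈ quotFiltration K (augIdeal K X) N 1 :=
  mk_mem_quotFiltration K _ N (by rw [Submodule.pow_one]; exact toFree_mem_augIdeal K X p)

theorem truncQuot_ι_mem (N : ℕ) (x : X) :
    truncQuot K X N (FreeAlgebra.ι K x) ∈ quotFiltration K (augIdeal K X) N 1 := by
  simpa using truncQuot_toFree_mem N (of K x)

theorem toFree_lift_bchLie [CharZero K] (x p : FreeLieAlgebra K X) (n : ℕ) :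
    toFree K X (FreeLieAlgebra.lift K ![x, p] (bchLie K n)) =
      FreeAlgebra.lift K ![toFree K X x, toFree K X p] (bchPoly K n) := by
  have h : (toFree K X).comp (FreeLieAlgebra.lift K ![x, p]) =
      (FreeAlgebra.lift K ![toFree K X x, toFree K X p]).toLieHom.comp (toFree K (Fin 2)) := by
    refine hom_ext fun i => ?_
    fin_cases i <;> simp
  rw [← toFree_bchLie]
  exact LieHom.congr_fun h _

theorem truncQuot_eq_truncLog [CharZero K] {N : ℕ} (p : FreeLieAlgebra K X) :
    truncLog K N (truncExp K N (truncQuot K X N (toFree K X p))) =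
      truncQuot K X N (toFree K X p) :=
  truncLog_truncExp
    ((isNilFiltration_quotFiltration K (augIdeal K X) N).pow_eq_zero (truncQuot_toFree_mem N p))

end TruncatedFreeAlgebra

section LogProd

open FreeLieAlgebra

variable {K L : Type*} [Field K] [LieRing L] [LieAlgebra K L]

local notation "γ" => LieModule.lowerCentralSeries K L L

theorem lift_sub_lift_mem {X : Type*} {f g : X → L} {n : ℕ} (h : ∀ i, f i - g i ∈ γ n)
    (w : FreeLieAlgebra K X) :
    FreeLieAlgebra.lift K f w - FreeLieAlgebra.lift K g w ∈ γ n := by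
  induction w using induction_lie with
  | of x => simpa using h x
  | zero => simp
  | add p q hp hq => rw [map_add, map_add, add_sub_add_comm]; exact add_mem hp hq
  | smul c p hp => rw [map_smul, map_smul, ← smul_sub]; exact (γ n).smul_mem c hp
  | lie p q hp hq =>
    rw [LieHom.map_lie, LieHom.map_lie]
    have h1 := lcs_antitone n.le_succ (lie_mem_lcs_succ (FreeLieAlgebra.lift K g p) hq)
    have h2 := lcs_antitone n.le_succ (lie_mem_lcs_succ (FreeLieAlgebra.lift K f q) hp)
    convert sub_mem h1 h2 using 1
    rw [lie_sub, lie_sub, ← lie_skew (FreeLieAlgebra.lift K f q) (FreeLieAlgebra.lift K f p),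
      ← lie_skew (FreeLieAlgebra.lift K f q) (FreeLieAlgebra.lift K g p)]
    abel

variable (K) in
/-- The element `c` of `L` is represented in every degree by the Lie polynomial
`log (e^x₁ ⋯ e^x_k)` in the entries `x₁, …, x_k` of a list. -/
def IsLogProd (l : List L) (c : L) : Prop :=
  ∀ N : ℕ, ∃ p : FreeLieAlgebra K L, FreeLieAlgebra.lift K id p - c ∈ γ N ∧
    truncExp K N (truncQuot K L N (toFree K L p)) =
      (l.map fun x => truncExp K N (truncQuot K L N (FreeAlgebra.ι K x))).prod

theorem isLogProd_nil : IsLogProd K ([] : List L) 0 := fun N => ⟨0, by simp, by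
  simp [truncExp_zero]⟩

theorem isLogProd_singleton (x : L) : IsLogProd K [x] x := fun N => ⟨of K x, by simp, by simp⟩

variable [CharZero K]

theorem lift_sub_mem_of_truncQuot_eq {N : ℕ} {p p' : FreeLieAlgebra K L}
    (h : truncQuot K L N (toFree K L p) = truncQuot K L N (toFree K L p')) (f : L → L) :
    FreeLieAlgebra.lift K f p - FreeLieAlgebra.lift K f p' ∈ γ N := by
  rw [← map_sub]
  refine LieHom.map_mem_lcs _ (mem_lcs_of_toFree_mem N ?_)
  rw [map_sub]
  exact Ideal.Quotient.eq.1 h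

/-- Taking logarithms, the two representatives agree up to degree N, hence modulo `γ N` after
evaluation in `L`. -/
theorem IsLogProd.unique (hL : IsLCSComplete K L) {l : List L} {c c' : L} (h : IsLogProd K l c)
    (h' : IsLogProd K l c') : c = c' := by
  refine hL.eq_of_sub_mem fun N => ?_
  obtain ⟨p, hp, he⟩ := h N
  obtain ⟨p', hp', he'⟩ := h' N
  have h1 : truncQuot K L N (toFree K L p) = truncQuot K L N (toFree K L p') := by
    rw [← truncQuot_eq_truncLog p, ← truncQuot_eq_truncLog p', he, he']
  have h2 := sub_mem (add_mem (lift_sub_mem_of_truncQuot_eq h1 id) hp') hp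
  convert h2 using 1
  abel

theorem IsLogProd.lcsHasSum_bch {x c c' : L} {l : List L} (h : IsLogProd K l c)
    (h' : IsLogProd K (x :: l) c') :
    LCSHasSum K (fun n : ℕ => FreeLieAlgebra.lift K ![x, c] (bchLie K n)) c' := by
  refine LCSHasSum.of_finset (fun m => Finset.range (m + 1)) (fun N => ?_) (fun m n hn => ?_)
  · obtain ⟨p, hp, he⟩ := h N
    obtain ⟨p', hp', he'⟩ := h' N
    -- The BCH partial sum is formed in the free Lie algebra, where its truncated image is log(e^x
    -- e^p) and equals that of p'. Passing from p to c afterwards changes values only within `γ N`.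
    let v := ∑ n ∈ Finset.range (N + 1), FreeLieAlgebra.lift K ![of K x, p] (bchLie K n)
    have hq : ∀ f : Fin 2 → FreeAlgebra K L, (truncQuot K L N).comp (FreeAlgebra.lift K f) =
        FreeAlgebra.lift K fun i => truncQuot K L N (f i) := by
      intro f
      ext i
      simp
    have h1 : truncQuot K L N (toFree K L v) = truncQuot K L N (toFree K L p') := by
      rw [← truncQuot_eq_truncLog p', he', List.map_cons, List.prod_cons, ← he,
        ← (isNilFiltration_quotFiltration K (augIdeal K L) N).sum_lift_bchPoly
          (truncQuot_ι_mem N x) (truncQuot_toFree_mem N p), map_sum, map_sum]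
      refine Finset.sum_congr rfl fun n _ => ?_
      rw [toFree_lift_bchLie]
      refine (DFunLike.congr_fun (hq _) _).trans ?_
      congr 2
      ext i
      fin_cases i <;> simp
    have h2 := lift_sub_mem_of_truncQuot_eq h1 id
    have h3 : ∑ n ∈ Finset.range (N + 1), FreeLieAlgebra.lift K ![x, c] (bchLie K n) -
        FreeLieAlgebra.lift K id v ∈ γ N := by
      rw [map_sum, ← Finset.sum_sub_distrib]
      refine sum_mem fun n _ => ?_
      have h4 : (FreeLieAlgebra.lift K (id : L → L)).comp (FreeLieAlgebra.lift K ![of K x, p]) =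
          FreeLieAlgebra.lift K ![x, FreeLieAlgebra.lift K id p] := by
        refine hom_ext fun i => ?_
        fin_cases i <;> simp
      rw [← LieHom.comp_apply, h4]
      refine lift_sub_lift_mem (fun i => ?_) _
      fin_cases i
      · simp
      · rw [← neg_mem_iff]
        simpa using hp
    convert add_mem (add_mem h3 h2) hp' using 1
    abel
  · refine LieHom.map_mem_lcs _ (bchLie_mem_lcs ?_)
    rw [Finset.mem_range] at hn
    omega

theorem IsLogProd.bch_eq (hL : IsLCSComplete K L) {x c c' : L} {l : List L} (h : IsLogProd K l c)
    (h' : IsLogProd K (x :: l) c') : bch K x c = c' :=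
  (Classical.epsilon_spec (p := fun c' =>
    LCSHasSum K (fun n : ℕ => FreeLieAlgebra.lift K ![x, c] (bchLie K n)) c')
      ⟨c', h.lcsHasSum_bch h'⟩).unique hL (h.lcsHasSum_bch h')

/-- The recursion of `bchProd` adds one left factor at a time, so associativity of • is not needed;
`hex` supplies the value of each tail. -/
theorem bchProd_eq_of_isLogProd (hL : IsLCSComplete K L) (hex : ∀ l : List L, ∃ c, IsLogProd K l c)
    {l : List L} {c : L} (h : IsLogProd K l c) : bchProd K l = c := by
  induction l generalizing c with
  | nil => exact isLogProd_nil.unique hL h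
  | cons x l ih =>
    cases l with
    | nil => exact (isLogProd_singleton x).unique hL h
    | cons y l =>
      obtain ⟨c₀, h₀⟩ := hex (y :: l)
      rw [bchProd, ih h₀]
      exact h₀.bch_eq hL h

end LogProd

/-! ### Tree sums in `L`. -/

section Trees

open FreeLieAlgebra BTree

variable {K L : Type*} [Field K] [LieRing L] [LieAlgebra K L]

local notation "γ" => LieModule.lowerCentralSeries K L L

theorem treeSum_sub_treeSum_mem {A : Type*} [Finite A] [LE A] [DecidableEq A] (a : A → L)
    {m n : ℕ} (h : m ≤ n) :
    treeSum K (fun _ => True) n a - treeSum K (fun _ => True) m a ∈ γ m := by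
  classical
  have hsub : posettedLE (fun _ : A => True) m ⊆ posettedLE (fun _ => True) n := fun t ht => by
    rw [mem_posettedLE] at ht ⊢
    exact ⟨ht.1.trans h, ht.2⟩
  rw [treeSum, treeSum, ← Finset.sum_sdiff hsub, add_sub_cancel_right]
  refine sum_mem fun t ht => (γ m).smul_mem _ (bracket_mem_lcs a t ?_)
  simp only [Finset.mem_sdiff, mem_posettedLE] at ht
  by_contra hlt
  exact ht.2 ⟨not_lt.1 hlt, ht.1.2⟩

theorem lcsHasSum_posettedTree {A : Type*} [Finite A] [LE A] [DecidableEq A] {a : A → L} {c : L}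
    (hc : ∀ m, treeSum K (fun _ => True) m a - c ∈ γ m) :
    LCSHasSum K (fun t : PosettedTree A => ((t.1.coeff : ℚ) : K) • t.1.bracket a) c := by
  classical
  refine LCSHasSum.of_finset
    (fun m => (posettedLE (fun _ : A => True) m).subtype BTree.IsPosetted) (fun m => ?_)
    (fun m t ht => ?_)
  · rw [Finset.sum_subtype_of_mem (fun t : BTree A => ((t.coeff : ℚ) : K) • t.bracket a)
      fun t ht => (mem_posettedLE.1 ht).2.1]
    exact hc m
  · refine (γ m).smul_mem _ (bracket_mem_lcs a t.1 ?_)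
    rw [Finset.mem_subtype, mem_posettedLE] at ht
    by_contra hlt
    exact ht ⟨not_lt.1 hlt, t.2, fun _ _ => trivial⟩

theorem bracket_neg {A : Type*} (a : A → L) (t : BTree A) :
    t.bracket (fun i => -a i) = (-1 : K) ^ t.numLeaves • t.bracket a := by
  induction t with
  | leaf i => simp [bracket, numLeaves_leaf]
  | node l r hl hr =>
    rw [bracket, bracket, hl, hr, numLeaves_node, smul_lie, lie_smul, smul_smul, pow_add]

theorem sum_range_posettedTrees {A : Type*} [Finite A] [LE A] [DecidableEq A] (f : BTree A → L)
    (m : ℕ) : ∑ n ∈ Finset.range m, ∑ t ∈ posettedTrees A (n + 1), f t =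
      ∑ t ∈ posettedLE (fun _ => True) m, f t := by
  classical
  rw [← Finset.sum_fiberwise_of_maps_to (t := Finset.range m)
    (g := fun t : BTree A => t.numLeaves - 1)]
  · refine Finset.sum_congr rfl fun n hn => Finset.sum_congr ?_ fun _ _ => rfl
    ext t
    have := t.numLeaves_pos
    rw [Finset.mem_range] at hn
    simp only [Finset.mem_filter, mem_posettedLE, mem_posettedTrees]
    constructor
    · rintro ⟨h1, h2⟩
      exact ⟨⟨by omega, h1, fun _ _ => trivial⟩, by omega⟩
    · rintro ⟨⟨h1, h2, -⟩, h3⟩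
      exact ⟨h2, by omega⟩
  · intro t ht
    have h1 := t.numLeaves_pos
    have h2 := (mem_posettedLE.1 ht).1
    rw [Finset.mem_range]
    omega

theorem lcsHasSum_alternating {A : Type*} [Finite A] [LE A] [DecidableEq A] {a : A → L} {c : L}
    (hc : ∀ m, treeSum K (fun _ => True) m (fun i => -a i) - c ∈ γ m) :
    LCSHasSum K (fun n : ℕ => (-1 : K) ^ n •
      ∑ t ∈ posettedTrees A (n + 1), ((t.coeff : ℚ) : K) • t.bracket a) (-c) := by
  refine LCSHasSum.of_finset Finset.range (fun m => ?_) (fun m n hn => ?_)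
  · have h : ∑ n ∈ Finset.range m, (-1 : K) ^ n •
        ∑ t ∈ posettedTrees A (n + 1), ((t.coeff : ℚ) : K) • t.bracket a =
        -treeSum K (fun _ => True) m (fun i => -a i) := by
      rw [treeSum, ← sum_range_posettedTrees, ← Finset.sum_neg_distrib]
      refine Finset.sum_congr rfl fun n _ => ?_
      rw [Finset.smul_sum, ← Finset.sum_neg_distrib]
      refine Finset.sum_congr rfl fun t ht => ?_
      rw [bracket_neg (K := K), (mem_posettedTrees.1 ht).2, smul_comm, pow_succ, mul_neg_one,
        neg_smul, smul_neg, neg_neg]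
    rw [h, neg_sub_neg, ← neg_mem_iff, neg_sub]
    exact hc m
  · refine (γ m).smul_mem _ (sum_mem fun t ht => (γ m).smul_mem _ (bracket_mem_lcs a t ?_))
    rw [(mem_posettedTrees.1 ht).2]
    rw [Finset.mem_range] at hn
    omega

variable [CharZero K]

theorem isLogProd_reverse {k : ℕ} {a : Fin k → L} {c : L}
    (hc : ∀ m, treeSum K (fun _ => True) m a - c ∈ γ m) :
    IsLogProd K (List.ofFn a).reverse c := by
  intro N
  refine ⟨treeSum K (fun _ => True) N fun i => of K (a i), ?_, ?_⟩
  · rw [map_treeSum]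
    simpa using hc N
  · have h := map_treeSum ((truncQuot K L N).toLieHom.comp (toFree K L)) (fun _ => True) N
      (fun i => of K (a i))
    have h1 := truncExp_treeSum (isNilFiltration_quotFiltration K (augIdeal K L) N)
      (a := fun i => truncQuot K L N (FreeAlgebra.ι K (a i))) (fun i => truncQuot_ι_mem N (a i))
    simp only [LieHom.comp_apply, AlgHom.coe_toLieHom, toFree_of] at h
    rw [h, h1, List.map_reverse, List.map_reverse, List.map_ofFn, List.map_ofFn]
    rfl

theorem prod_truncExp_mul_prod_truncExp_neg {Q : Type*} [Ring Q] [Algebra K Q] {N : ℕ}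
    (l : List Q) (hl : ∀ x ∈ l, x ^ (N + 1) = 0) :
    (l.map (truncExp K N)).prod * (l.reverse.map fun x => truncExp K N (-x)).prod = 1 := by
  induction l with
  | nil => simp
  | cons x l ih =>
    have hx : (-x) ^ (N + 1) = 0 := by rw [neg_pow, hl x (by simp), mul_zero]
    have h := truncExp_neg_mul (K := K) hx
    rw [neg_neg] at h
    rw [List.map_cons, List.prod_cons, List.reverse_cons, List.map_append, List.prod_append,
      mul_assoc, ← mul_assoc _ _ (List.prod _), ih fun y hy => hl y (List.mem_cons_of_mem _ hy)]
    simpa using h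

theorem isLogProd_neg {k : ℕ} {a : Fin k → L} {c : L}
    (hc : ∀ m, treeSum K (fun _ => True) m (fun i => -a i) - c ∈ γ m) :
    IsLogProd K (List.ofFn a) (-c) := by
  intro N
  have hF := isNilFiltration_quotFiltration K (augIdeal K L) N
  have hmem : ∀ i, -truncQuot K L N (FreeAlgebra.ι K (a i)) ∈
      quotFiltration K (augIdeal K L) N 1 := fun i => neg_mem (truncQuot_ι_mem N (a i))
  refine ⟨-treeSum K (fun _ => True) N fun i => -of K (a i), ?_, ?_⟩
  · rw [map_neg, map_treeSum, neg_sub_neg, ← neg_mem_iff, neg_sub]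
    simpa using hc N
  · have h := map_treeSum ((truncQuot K L N).toLieHom.comp (toFree K L)) (fun _ => True) N
      (fun i => -of K (a i))
    simp only [LieHom.comp_apply, AlgHom.coe_toLieHom, toFree_of, map_neg] at h
    have h1 := truncExp_treeSum hF hmem
    have h2 := truncExp_neg_mul (K := K)
      (hF.pow_eq_zero (neg_mem (treeSum_mem (K := K) hF hmem fun _ => True)))
    have h3 := prod_truncExp_mul_prod_truncExp_neg (K := K) (N := N)
      (List.ofFn fun i => truncQuot K L N (FreeAlgebra.ι K (a i))) (by
        intro x hx
        obtain ⟨i, rfl⟩ := (List.mem_ofFn' _ _).1 hx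
        exact hF.pow_eq_zero (truncQuot_ι_mem N (a i)))
    rw [map_neg, map_neg, h]
    rw [neg_neg, h1] at h2
    have h4 : ((List.ofFn fun i => -truncQuot K L N (FreeAlgebra.ι K (a i))).reverse.map
        (truncExp K N)) = (List.ofFn fun i => truncQuot K L N (FreeAlgebra.ι K (a i))).reverse.map
          fun x => truncExp K N (-x) := by
      rw [List.map_reverse, List.map_reverse, List.map_ofFn, List.map_ofFn]
      rfl
    rw [h4] at h2
    -- The product of the e^{a_i} and e^{-Z(-a)} are a left and a right inverse of the same reversed
    -- product of the e^{-a_i}.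
    rw [← left_inv_eq_right_inv h3 h2, List.map_ofFn, List.map_ofFn]
    rfl

/-- The limit of the tree sums of the reversed list is a witness, so the tree expansion also
provides existence. -/
theorem exists_isLogProd (hL : IsLCSComplete K L) (l : List L) : ∃ c, IsLogProd K l c := by
  obtain ⟨c, hc⟩ := hL.exists_limit
    (fun m => treeSum K (fun _ => True) m l.reverse.get) fun m n h => treeSum_sub_treeSum_mem _ h
  refine ⟨c, ?_⟩
  have := isLogProd_reverse hc
  rwa [List.ofFn_get, List.reverse_reverse] at this

end Trees

end PosettedTreeExpansion

theorem theorem1 {K L : Type*} [Field K] [CharZero K] [LieRing L] [LieAlgebra K L]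
    (hL : IsLCSComplete K L) :
    (∀ (k : ℕ) (_ : 0 < k) (a : Fin k → L),
      LCSHasSum K (fun t : PosettedTree (Fin k) => ((t.1.coeff : ℚ) : K) • t.1.bracket a)
        (bchProd K (List.ofFn a).reverse) ∧
      LCSHasSum K (fun n : ℕ => (-1 : K) ^ n •
          ∑ t ∈ posettedTrees (Fin k) (n + 1), ((t.coeff : ℚ) : K) • t.bracket a)
        (bchProd K (List.ofFn a))) ∧
    (∀ a b : L,
      LCSHasSum K
        (fun t : PosettedTree (Fin 2) => ((t.1.coeff : ℚ) : K) • t.1.bracket ![b, a])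
        (bch K a b)) := by
  have key : ∀ (k : ℕ) (a : Fin k → L),
      LCSHasSum K (fun t : PosettedTree (Fin k) => ((t.1.coeff : ℚ) : K) • t.1.bracket a)
        (bchProd K (List.ofFn a).reverse) := by
    intro k a
    obtain ⟨c, hc⟩ := hL.exists_limit (fun m => BTree.treeSum K (fun _ => True) m a)
      fun m n h => treeSum_sub_treeSum_mem _ h
    rw [bchProd_eq_of_isLogProd hL (exists_isLogProd hL) (isLogProd_reverse hc)]
    exact lcsHasSum_posettedTree hc
  refine ⟨fun k _ a => ⟨key k a, ?_⟩, fun a b => ?_⟩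
  · obtain ⟨c, hc⟩ := hL.exists_limit
      (fun m => BTree.treeSum K (fun _ => True) m fun i => -a i)
      fun m n h => treeSum_sub_treeSum_mem _ h
    rw [bchProd_eq_of_isLogProd hL (exists_isLogProd hL) (isLogProd_neg hc)]
    exact lcsHasSum_alternating hc
  · simpa [List.ofFn_succ, bchProd] using key 2 ![b, a]
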